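/- Let $n,d\ge 1$ be integers, let $(a_i^0)_{i\ge 1}$ be a nonrandom sequence in $\mathbb{R}^n$, let $X_0\in\mathbb{R}^{n\times d}$, and let $\Sigma\in\mathbb{R}^{(n+d)\times(n+d)}$. For a sample size $m$ let $A_0=A_0(m)$ be the $m\times n$ matrix with rows $(a_1^0)^\top,\dots,(a_m^0)^\top$, put $C_0=[A_0\;\; A_0X_0]$, and let $C=C(m)=C_0+\widetilde C$ be the matrix of observations, where $\widetilde C=(\delta_{ij})_{1\le i\le m,\,1\le j\le n+d}$ is the matrix of the first $m$ of a sequence of random error vectors $\tilde c_i=(\delta_{ij})_{j=1}^{n+d}$, $i\ge1$. Assume that the vectors $\tilde c_i$ are mutually independent, that $\mathsf{E}\,\delta_{ij}=0$ and $\mathsf{E}\,\delta_{ij}\delta_{ik}=\Sigma_{jk}$ for all $i,j,k$, and that $\operatorname{rank}\left(\Sigma\binom{X_0}{-I_d}\right)=d$. The total least squares (TLS) estimator $\widehat X=\widehat X(m)$ of $X_0$ is defined as follows. Let $\Delta$ be any $m\times(n+d)$ matrix that minimizes the Frobenius norm $\|\Delta(\Sigma^{1/2})^\dagger\|_F$ subject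 to $\Delta(I-\Sigma\Sigma^\dagger)=0$ and $\operatorname{rank}(C-\Delta)\le n$, where $\dagger$ denotes the Moore--Penrose pseudoinverse. Let $\widehat X_{\rm ext}$ be any $(n+d)\times d$ matrix of rank $d$ with $(C-\Delta)\widehat X_{\rm ext}=0$. If the lower $d\times d$ block of $\widehat X_{\rm ext}$ is nonsingular, then $\widehat X$ is the $n\times d$ matrix for which $\binom{\widehat X}{-I_d}=\widehat X_{\rm ext}T$ with some nonsingular $T$; otherwise the estimation fails and $\widehat X$ is an arbitrary $n\times d$ matrix. Theorem (Shklyar 2011, Theorem 4.3). Suppose that for some real $r$ with $1\le r\le 2$ and some $m_0\ge1$, $$\sup_{i\ge1,\;1\le j\le n+d}\mathsf{E}|\delta_{ij}|^{2r}<\infty ,\qquad \lambda_{\min}(A_0^\top A_0)>0\ \text{ for all } m\ge m_0,\qquad \sum_{m=m_0}^\infty\frac{1}{\lambda_{\min}(A_0^\top A_0)^{r}}<\infty ,$$ where $\lambda_{\min}$ denotes the smallest eigenvalue. Then matrices $\Delta$ and $\widehat X_{\rm ext}$ as above exist for every $m$ and every outcome; and, for every choice of $\Delta$ and $\widehat X_{\rm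 ext}$ for each $m$ and each outcome, almost surely the lower $d\times d$ block of $\widehat X_{\rm ext}$ is nonsingular for all sufficiently large $m$, and $\widehat X\to X_0$ as $m\to\infty$. -/

import Mathlib

open MeasureTheory ProbabilityTheory Filter Topology Matrix

noncomputable section

namespace TLS

/-! ### Matrix preliminaries -/

/-- `B` satisfies the four Penrose equations for `A`: it is the Moore–Penrose pseudoinverse. -/
structure IsMoorePenrose {p q : Type*} [Fintype p] [Fintype q]
    (A : Matrix p q ℝ) (B : Matrix q p ℝ) : Prop where
  mul_mul_left : A * B * A = A
  mul_mul_right : B * A * B = B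
  symm_left : (A * B)ᵀ = A * B
  symm_right : (B * A)ᵀ = B * A

theorem IsMoorePenrose.unique {p q : Type*} [Fintype p] [Fintype q]
    {A : Matrix p q ℝ} {B B' : Matrix q p ℝ}
    (h : IsMoorePenrose A B) (h' : IsMoorePenrose A B') : B = B' := by
  have e1 : A * B = A * B' := by
    calc A * B = (A * B)ᵀ := h.symm_left.symm
      _ = ((A * B') * (A * B))ᵀ := by rw [← Matrix.mul_assoc, h'.mul_mul_left]
      _ = (A * B)ᵀ * (A * B')ᵀ := Matrix.transpose_mul _ _
      _ = A * B' := by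
        rw [h.symm_left, h'.symm_left, ← Matrix.mul_assoc, h.mul_mul_left]
  have e2 : B * A = B' * A := by
    calc B * A = (B * A)ᵀ := h.symm_right.symm
      _ = ((B * A) * (B' * A))ᵀ := by
        rw [Matrix.mul_assoc, ← Matrix.mul_assoc A, h'.mul_mul_left]
      _ = (B' * A)ᵀ * (B * A)ᵀ := Matrix.transpose_mul _ _
      _ = B' * A := by
        rw [h.symm_right, h'.symm_right, Matrix.mul_assoc, ← Matrix.mul_assoc A, h.mul_mul_left]
  calc B = B * A * B := h.mul_mul_right.symm
    _ = B' * A * B' := by rw [e2, Matrix.mul_assoc, e1, ← Matrix.mul_assoc]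
    _ = B' := h'.mul_mul_right

theorem exists_isMoorePenrose {p q : Type*} [Fintype p] [Fintype q] (A : Matrix p q ℝ) :
    ∃ B, IsMoorePenrose A B := by
  classical
  set S : Matrix q q ℝ := Aᵀ * A with hS
  have hSs : IsSelfAdjoint S := by
    rw [IsSelfAdjoint, Matrix.star_eq_conjTranspose, Matrix.conjTranspose_eq_transpose_of_trivial,
      hS, Matrix.transpose_mul, Matrix.transpose_transpose]
  set G : Matrix q q ℝ := cfc (fun x : ℝ => x⁻¹) S with hG
  have hfin : (spectrum ℝ S).Finite := Matrix.finite_real_spectrum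
  have hc : ∀ f : ℝ → ℝ, ContinuousOn f (spectrum ℝ S) := fun f => hfin.continuousOn f
  have hid : cfc (fun x : ℝ => x) S = S := cfc_id' ℝ S
  have hGS : G * S = cfc (fun x : ℝ => x⁻¹ * x) S := by
    rw [cfc_mul _ _ S (hc _) (hc _), hid]
  have hSG : S * G = G * S := by
    have h1 : S * G = cfc (fun x : ℝ => x * x⁻¹) S := by
      rw [cfc_mul _ _ S (hc _) (hc _), hid]
    rw [hGS, h1]
    simp only [mul_comm]
  have hSGS : S * G * S = S := by
    have h1 : cfc (fun x : ℝ => x⁻¹ * x * x) S = cfc (fun x : ℝ => x⁻¹ * x) S * S := by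
      rw [cfc_mul _ _ S (hc _) (hc _), hid]
    have h2 : (fun x : ℝ => x⁻¹ * x * x) = fun x => x := by
      funext x
      by_cases hx : x = 0 <;> simp [hx]
    rw [hSG, hGS, ← h1, h2, hid]
  have hSt : Sᵀ = S := by
    rw [hS, Matrix.transpose_mul, Matrix.transpose_transpose]
  have hGt : Gᵀ = G := by
    have h1 : IsSelfAdjoint G := cfc_predicate _ S
    rwa [IsSelfAdjoint, Matrix.star_eq_conjTranspose,
      Matrix.conjTranspose_eq_transpose_of_trivial] at h1
  have hAGS : A * (G * S) = A := by
    have h0 : (A - A * (G * S))ᵀ * (A - A * (G * S)) = 0 := by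
      have h1 : (A - A * (G * S))ᵀ = Aᵀ - S * G * Aᵀ := by
        rw [Matrix.transpose_sub, Matrix.transpose_mul, Matrix.transpose_mul, hSt, hGt]
      have h2 : Aᵀ * (A - A * (G * S)) = 0 := by
        rw [Matrix.mul_sub, ← Matrix.mul_assoc, ← hS, ← Matrix.mul_assoc, hSGS, sub_self]
      rw [h1, Matrix.sub_mul, Matrix.mul_assoc (S * G), h2, Matrix.mul_zero, sub_zero]
    rw [← Matrix.conjTranspose_eq_transpose_of_trivial,
      Matrix.conjTranspose_mul_self_eq_zero] at h0
    exact (sub_eq_zero.mp h0).symm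
  refine ⟨G * Aᵀ, ?_, ?_, ?_, ?_⟩
  · rw [Matrix.mul_assoc, Matrix.mul_assoc, ← hS, hAGS]
  · have h1 : S * G * Aᵀ = Aᵀ := by
      have h2 := congrArg Matrix.transpose hAGS
      rwa [Matrix.transpose_mul, Matrix.transpose_mul, hSt, hGt] at h2
    calc G * Aᵀ * A * (G * Aᵀ) = G * (S * G * Aᵀ) := by simp only [hS, Matrix.mul_assoc]
      _ = G * Aᵀ := by rw [h1]
  · simp only [Matrix.transpose_mul, Matrix.transpose_transpose, hGt, Matrix.mul_assoc]
  · rw [Matrix.mul_assoc, ← hS, Matrix.transpose_mul, hSt, hGt, hSG]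

/-- The Moore–Penrose pseudoinverse of a real matrix. -/
def pinv {p q : Type*} [Fintype p] [Fintype q] (A : Matrix p q ℝ) : Matrix q p ℝ :=
  Classical.choose (exists_isMoorePenrose A)

theorem isMoorePenrose_pinv {p q : Type*} [Fintype p] [Fintype q] (A : Matrix p q ℝ) :
    IsMoorePenrose A (pinv A) :=
  Classical.choose_spec (exists_isMoorePenrose A)

/-- The symmetric square root `S^{1/2}` of a positive semidefinite matrix `S`. -/
def psdSqrt {q : Type*} [Fintype q] [DecidableEq q] (S : Matrix q q ℝ) : Matrix q q ℝ :=
  cfc Real.sqrt S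

theorem psdSqrt_mul_self {q : Type*} [Fintype q] [DecidableEq q] {S : Matrix q q ℝ}
    (hS : S.PosSemidef) : psdSqrt S * psdSqrt S = S := by
  have hs : IsSelfAdjoint S := hS.1
  have hc : ∀ f : ℝ → ℝ, ContinuousOn f (spectrum ℝ S) :=
    fun f => (Matrix.finite_real_spectrum (A := S)).continuousOn f
  rw [psdSqrt, ← cfc_mul _ _ S (hc _) (hc _)]
  conv_rhs => rw [← cfc_id' ℝ S]
  refine cfc_congr fun x hx => ?_
  rw [hS.1.spectrum_real_eq_range_eigenvalues] at hx
  obtain ⟨i, rfl⟩ := hx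
  exact Real.mul_self_sqrt (hS.eigenvalues_nonneg i)

open scoped MatrixOrder in
theorem psdSqrt_posSemidef {q : Type*} [Fintype q] [DecidableEq q] (S : Matrix q q ℝ) :
    (psdSqrt S).PosSemidef := by
  rw [← Matrix.nonneg_iff_posSemidef]
  exact cfc_nonneg fun x _ => Real.sqrt_nonneg x

/-- The Frobenius norm. -/
def frobNorm {p q : Type*} [Fintype p] [Fintype q] (M : Matrix p q ℝ) : ℝ :=
  Real.sqrt (∑ i, ∑ j, M i j ^ 2)

/-- The smallest (real) eigenvalue; used for symmetric matrices of positive size. -/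
def lambdaMin {q : Type*} [Fintype q] [DecidableEq q] (M : Matrix q q ℝ) : ℝ :=
  sInf (spectrum ℝ M)

/-- For a symmetric matrix of positive size, `lambdaMin` is attained, and is the least eigenvalue. -/
theorem isLeast_lambdaMin {q : Type*} [Fintype q] [DecidableEq q] [Nonempty q]
    {M : Matrix q q ℝ} (hM : M.IsHermitian) :
    IsLeast (Set.range hM.eigenvalues) (lambdaMin M) := by
  rw [lambdaMin, hM.spectrum_real_eq_range_eigenvalues]
  exact ⟨(Set.range_nonempty _).csInf_mem (Set.finite_range _),
    fun x hx => csInf_le (Set.finite_range _).bddBelow hx⟩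

/-! ### The model

Observations are indexed by `i = 0, 1, 2, …`; the sample of size `m` consists of the first `m`. -/

/-- The `m × n` matrix `A₀` of true regressors, with rows `a 0, …, a (m - 1)`. -/
def trueA {n : ℕ} (a : ℕ → Fin n → ℝ) (m : ℕ) : Matrix (Fin m) (Fin n) ℝ :=
  Matrix.of fun i j => a i j

/-- The `m × (n + d)` matrix `C₀ = [A₀  B₀]` of true variables, where `B₀ = A₀ X₀`. -/
def trueC {n d : ℕ} (a : ℕ → Fin n → ℝ) (X0 : Matrix (Fin n) (Fin d) ℝ) (m : ℕ) :
    Matrix (Fin m) (Fin n ⊕ Fin d) ℝ :=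
  Matrix.fromCols (trueA a m) (trueA a m * X0)

/-- The `m × (n + d)` matrix of errors, with rows `e 0, …, e (m - 1)`. -/
def errC {n d : ℕ} (e : ℕ → Fin n ⊕ Fin d → ℝ) (m : ℕ) : Matrix (Fin m) (Fin n ⊕ Fin d) ℝ :=
  Matrix.of fun i j => e i j

/-- The `m × (n + d)` matrix of observations `C = C₀ + C̃`. -/
def obsC {n d : ℕ} (a : ℕ → Fin n → ℝ) (X0 : Matrix (Fin n) (Fin d) ℝ)
    (e : ℕ → Fin n ⊕ Fin d → ℝ) (m : ℕ) : Matrix (Fin m) (Fin n ⊕ Fin d) ℝ :=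
  trueC a X0 m + errC e m

/-- The `(n + d) × d` augmented matrix with blocks `X` and `-I`. -/
def augment {n d : ℕ} (X : Matrix (Fin n) (Fin d) ℝ) : Matrix (Fin n ⊕ Fin d) (Fin d) ℝ :=
  Matrix.fromRows X (-1)

/-! ### The total least squares estimator -/

/-- The constraints of the TLS problem: `D (I - P_S) = 0`, where `P_S = S S†` is the orthogonal
projector onto the column space of `S`, and `rank (C - D) ≤ n`. -/
def TLSFeasible {n d m : ℕ} (S : Matrix (Fin n ⊕ Fin d) (Fin n ⊕ Fin d) ℝ)
    (C D : Matrix (Fin m) (Fin n ⊕ Fin d) ℝ) : Prop :=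
  D * (1 - S * pinv S) = 0 ∧ (C - D).rank ≤ n

/-- `D` minimizes `‖D (S^{1/2})†‖_F` under the TLS constraints. -/
def IsTLSMinimizer {n d m : ℕ} (S : Matrix (Fin n ⊕ Fin d) (Fin n ⊕ Fin d) ℝ)
    (C D : Matrix (Fin m) (Fin n ⊕ Fin d) ℝ) : Prop :=
  TLSFeasible S C D ∧ ∀ D' : Matrix (Fin m) (Fin n ⊕ Fin d) ℝ, TLSFeasible S C D' →
    frobNorm (D * pinv (psdSqrt S)) ≤ frobNorm (D' * pinv (psdSqrt S))

/-- `(Xext, Xhat)` is a possible outcome of TLS estimation from the observations `C`: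
for some minimizer `D`, the `d` columns of `Xext` are linearly independent and lie in the kernel
of `C - D`; and, if the lower `d × d` block of `Xext` is nonsingular, then `Xhat` comes from
transforming `Xext`, by right multiplication by a nonsingular matrix, to the form with blocks
`Xhat` and `-I`. If the lower block is singular, estimation fails, and `Xhat` may be any matrix. -/
structure IsTLSEstimator {n d m : ℕ} (S : Matrix (Fin n ⊕ Fin d) (Fin n ⊕ Fin d) ℝ)
    (C : Matrix (Fin m) (Fin n ⊕ Fin d) ℝ) (Xext : Matrix (Fin n ⊕ Fin d) (Fin d) ℝ)
    (Xhat : Matrix (Fin n) (Fin d) ℝ) : Prop where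
  exists_minimizer : ∃ D, IsTLSMinimizer S C D ∧ (C - D) * Xext = 0
  rank_eq : Xext.rank = d
  normalize : IsUnit Xext.toRows₂ →
    ∃ T : Matrix (Fin d) (Fin d) ℝ, IsUnit T ∧ Xext * T = augment Xhat

end TLS

end

/-! Write `R = psdSqrt S`, `A` for the true regressors, `E` for the errors and `λ` for the least
eigenvalue of `Aᵀ A`. In the normalization `Xᵀ S X = 1`, total least squares minimizes `‖C X‖²`: an
admissible correction factors as `D = (D R†) R`, so `(C - D) X = 0` forces `‖C X‖ ≤ ‖D R†‖`, while
`D = C X Xᵀ S` is admissible and attains equality.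

Expanding with `C = C₀ + E`, one expects `‖C X‖² ≈ ‖A B‖² + m ‖R X‖²`, where the residual `B = X₁ +
X₀ X₂` vanishes exactly on the columns of `augment X0`. Under the normalization the second term is
the constant `m d`, so the minimizer has small `B`, that is, it spans almost the same space as
`augment X0`. The rank hypothesis makes `R` injective on that space, which allows the normalization
and keeps the lower block of `X` invertible. `IsTLSEstimator.frobSq_sub_le` makes this quantitative
and deterministic: a relative error `ε` in the approximation costs a squared error `O(ε)` in the
estimator.

By `abs_frobSq_sub_le`, `ε` is controlled by two random quantities, with `U` an orthonormal basis of
the columns of `A`. The matrix `(Eᵀ E - m S) / λ` tends to zero by a strong law for independent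
variables with bounded moments of order `r` (truncation, martingale convergence, Kronecker's lemma).
For `‖Uᵀ E‖² / λ` a Rosenthal-type inequality bounds the moments of order `2 r` of the entries of
`Uᵀ E` uniformly in `m`; since `∑ λ⁻ʳ` converges, so does the sum of the expected `r`-th powers, and
the terms tend to zero almost surely. -/

namespace TLS

/-! ### Frobenius norms, isometries and pseudoinverses. -/

section LinearAlgebra

variable {p q s : Type*} [Fintype p] [Fintype q] [Fintype s]

/-- The squared Frobenius norm. -/
def frobSq (M : Matrix p q ℝ) : ℝ := ∑ i, ∑ j, M i j ^ 2

theorem frobNorm_eq_sqrt (M : Matrix p q ℝ) : frobNorm M = Real.sqrt (frobSq M) := rfl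

theorem frobSq_nonneg (M : Matrix p q ℝ) : 0 ≤ frobSq M :=
  Finset.sum_nonneg fun _ _ => Finset.sum_nonneg fun _ _ => sq_nonneg _

theorem sq_apply_le_frobSq (M : Matrix p q ℝ) (i : p) (j : q) : M i j ^ 2 ≤ frobSq M := by
  refine le_trans ?_ (Finset.single_le_sum (f := fun i => ∑ j, M i j ^ 2)
    (fun _ _ => Finset.sum_nonneg fun _ _ => sq_nonneg _) (Finset.mem_univ i))
  exact Finset.single_le_sum (f := fun j => M i j ^ 2) (fun _ _ => sq_nonneg _) (Finset.mem_univ j)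

theorem eq_zero_of_frobSq_le_zero {M : Matrix p q ℝ} (h : frobSq M ≤ 0) : M = 0 := by
  ext i j
  have h1 := sq_apply_le_frobSq M i j
  have h2 : M i j ^ 2 = 0 := le_antisymm (h1.trans h) (sq_nonneg _)
  simpa using h2

@[simp] theorem frobSq_zero : frobSq (0 : Matrix p q ℝ) = 0 := by simp [frobSq]

@[simp] theorem frobSq_neg (M : Matrix p q ℝ) : frobSq (-M) = frobSq M := by simp [frobSq]

theorem frobSq_transpose (M : Matrix p q ℝ) : frobSq Mᵀ = frobSq M := by
  simp only [frobSq, Matrix.transpose_apply]; exact Finset.sum_comm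

theorem frobSq_eq_trace (M : Matrix p q ℝ) : frobSq M = trace (Mᵀ * M) := by
  simp only [frobSq, trace, diag_apply, mul_apply, transpose_apply]
  rw [Finset.sum_comm]
  simp only [sq]

theorem frobSq_add (M N : Matrix p q ℝ) :
    frobSq (M + N) = frobSq M + 2 * trace (Mᵀ * N) + frobSq N := by
  simp only [frobSq_eq_trace, transpose_add, Matrix.add_mul, Matrix.mul_add, trace_add]
  have : trace (Nᵀ * M) = trace (Mᵀ * N) := by
    rw [← trace_transpose, transpose_mul, transpose_transpose]
  rw [this]; ring

theorem frobSq_add_le (M N : Matrix p q ℝ) : frobSq (M + N) ≤ 2 * frobSq M + 2 * frobSq N := by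
  simp only [frobSq, Finset.mul_sum, ← Finset.sum_add_distrib]
  refine Finset.sum_le_sum fun i _ => Finset.sum_le_sum fun j _ => ?_
  simp only [Matrix.add_apply]
  nlinarith [sq_nonneg (M i j - N i j)]

theorem frobSq_sub_le (M N : Matrix p q ℝ) : frobSq (M - N) ≤ 2 * frobSq M + 2 * frobSq N := by
  have := frobSq_add_le M (-N)
  rwa [← sub_eq_add_neg, frobSq_neg] at this

theorem trace_transpose_mul_sq_le (M N : Matrix p q ℝ) :
    trace (Mᵀ * N) ^ 2 ≤ frobSq M * frobSq N := by
  have h := Finset.sum_mul_sq_le_sq_mul_sq (Finset.univ : Finset (p × q))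
    (fun x => M x.1 x.2) (fun x => N x.1 x.2)
  simp only [Fintype.sum_prod_type] at h
  have e : trace (Mᵀ * N) = ∑ i, ∑ j, M i j * N i j := by
    simp only [trace, diag_apply, mul_apply, transpose_apply]
    exact Finset.sum_comm
  rw [e]; exact h

theorem frobSq_mul_le (M : Matrix p q ℝ) (N : Matrix q s ℝ) :
    frobSq (M * N) ≤ frobSq M * frobSq N := by
  rw [← frobSq_transpose N]
  unfold frobSq
  rw [Finset.sum_mul_sum]
  refine Finset.sum_le_sum fun i _ => Finset.sum_le_sum fun j _ => ?_
  exact Finset.sum_mul_sq_le_sq_mul_sq Finset.univ (fun k => M i k) (fun k => N k j)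

theorem frobSq_isometry_mul [DecidableEq q] {Z : Matrix p q ℝ} (hZ : Zᵀ * Z = 1)
    (M : Matrix q s ℝ) : frobSq (Z * M) = frobSq M := by
  rw [frobSq_eq_trace, frobSq_eq_trace, transpose_mul, Matrix.mul_assoc, ← Matrix.mul_assoc Zᵀ, hZ,
    Matrix.one_mul]

theorem frobSq_mul_transpose_isometry [DecidableEq q] {Z : Matrix p q ℝ} (hZ : Zᵀ * Z = 1)
    (M : Matrix s q ℝ) : frobSq (M * Zᵀ) = frobSq M := by
  rw [← frobSq_transpose, transpose_mul, transpose_transpose, frobSq_isometry_mul hZ,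
    frobSq_transpose]

/-- Pythagoras: `M * Z * Zᵀ` is the orthogonal projection of the rows of `M` on the column space of
`Z`. -/
theorem frobSq_mul_isometry_le [DecidableEq q] {Z : Matrix p q ℝ} (hZ : Zᵀ * Z = 1)
    (M : Matrix s p ℝ) : frobSq (M * Z) ≤ frobSq M := by
  have h0 := frobSq_nonneg (M - M * Z * Zᵀ)
  have h1 : M = (M - M * Z * Zᵀ) + M * Z * Zᵀ := by abel
  have h2 := frobSq_add (M - M * Z * Zᵀ) (M * Z * Zᵀ)
  rw [← h1, frobSq_mul_transpose_isometry hZ] at h2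
  have h3 : trace ((M - M * Z * Zᵀ)ᵀ * (M * Z * Zᵀ)) = 0 := by
    rw [← Matrix.mul_assoc, trace_mul_comm, ← Matrix.mul_assoc, transpose_sub, Matrix.mul_sub]
    simp only [transpose_mul, transpose_transpose, ← Matrix.mul_assoc]
    rw [hZ, Matrix.one_mul, sub_self, Matrix.zero_mul, Matrix.zero_mul, trace_zero]
  rw [h3] at h2
  linarith

theorem frobSq_one [DecidableEq q] : frobSq (1 : Matrix q q ℝ) = Fintype.card q := by
  rw [frobSq_eq_trace, transpose_one, Matrix.one_mul, trace_one]

theorem frobSq_of_isometry [DecidableEq q] {Z : Matrix p q ℝ} (hZ : Zᵀ * Z = 1) :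
    frobSq Z = Fintype.card q := by
  rw [frobSq_eq_trace, hZ, trace_one]

/-! ### Full column rank and normalization -/

theorem eq_zero_of_rank_eq_card [DecidableEq q] {Z : Matrix p q ℝ} (h : Z.rank = Fintype.card q)
    {V : Matrix q s ℝ} (hV : Z * V = 0) : V = 0 := by
  have h1 := rank_add_rank_le_card_of_mul_eq_zero hV
  have h2 : V.rank = 0 := by omega
  have h3 : (LinearMap.range V.mulVecLin) = ⊥ := Submodule.finrank_eq_zero.mp h2
  classical
  ext i j
  have h4 : V.mulVecLin (Pi.single j 1) ∈ LinearMap.range V.mulVecLin := ⟨_, rfl⟩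
  rw [h3, Submodule.mem_bot] at h4
  simpa using congrFun h4 i

theorem exists_ne_zero_of_rank_ne_card {p : Type*} [DecidableEq q] {Z : Matrix p q ℝ}
    (h : Z.rank ≠ Fintype.card q) : ∃ V : Matrix q q ℝ, V ≠ 0 ∧ Z * V = 0 := by
  have h1 : ¬ Function.Injective Z.mulVecLin := by
    intro hi
    apply h
    rw [Matrix.rank, LinearMap.finrank_range_of_inj hi, Module.finrank_fintype_fun_eq_card]
  rw [← LinearMap.ker_eq_bot, Submodule.eq_bot_iff] at h1
  push Not at h1
  obtain ⟨v, hv, hv0⟩ := h1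
  obtain ⟨i, hi⟩ := Function.ne_iff.mp hv0
  refine ⟨Matrix.of fun i _ => v i, fun h0 => hi ?_, ?_⟩
  · simpa using congrFun (congrFun h0 i) i
  · ext k l
    exact congrFun (LinearMap.mem_ker.mp hv) k

theorem isUnit_of_rank_eq_card [DecidableEq q] {G : Matrix q q ℝ}
    (h : G.rank = Fintype.card q) : IsUnit G := by
  rw [← mulVec_injective_iff_isUnit]
  have : Function.Injective G.mulVecLin := by
    rw [← LinearMap.ker_eq_bot, LinearMap.ker_eq_bot']
    intro v hv
    have := eq_zero_of_rank_eq_card h (V := Matrix.of fun i (_ : Unit) => v i)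
      (by ext i j; exact congrFun hv i)
    ext i
    simpa using congrFun (congrFun this i) ()
  exact this

theorem isUnit_of_mul_eq_zero [DecidableEq q] {G : Matrix q q ℝ}
    (h : ∀ V : Matrix q q ℝ, G * V = 0 → V = 0) : IsUnit G := by
  by_contra hG
  obtain ⟨V, hV0, hV⟩ := exists_ne_zero_of_rank_ne_card
    (Z := G) (fun hr => hG (isUnit_of_rank_eq_card hr))
  exact hV0 (h V hV)

theorem psdSqrt_transpose [DecidableEq q] (S : Matrix q q ℝ) : (psdSqrt S)ᵀ = psdSqrt S := by
  have := (psdSqrt_posSemidef S).1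
  rwa [Matrix.IsHermitian, conjTranspose_eq_transpose_of_trivial] at this

theorem posSemidef_gram (Z : Matrix p q ℝ) : (Zᵀ * Z).PosSemidef := by
  have := posSemidef_conjTranspose_mul_self Z
  rwa [conjTranspose_eq_transpose_of_trivial] at this

/-- A matrix of full column rank has an orthonormal basis of its column space. -/
theorem exists_mul_isometry [DecidableEq q] {Z : Matrix p q ℝ}
    (h : Z.rank = Fintype.card q) :
    ∃ T : Matrix q q ℝ, (Z * T)ᵀ * (Z * T) = 1 ∧
      ∃ K : Matrix q q ℝ, T * K = 1 ∧ K * T = 1 := by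
  -- Polar decomposition: `Z * R⁻¹` is the isometric factor of `Z`.
  set R := psdSqrt (Zᵀ * Z) with hR
  have hRR : R * R = Zᵀ * Z := psdSqrt_mul_self (posSemidef_gram Z)
  have hu : IsUnit (R * R) := by
    rw [hRR]
    exact isUnit_of_rank_eq_card (by rw [rank_transpose_mul_self, h])
  have hd : IsUnit R.det := by
    rw [isUnit_iff_isUnit_det, det_mul] at hu
    exact isUnit_of_mul_isUnit_left hu
  refine ⟨R⁻¹, ?_, R, nonsing_inv_mul R hd, mul_nonsing_inv R hd⟩
  rw [transpose_mul, transpose_nonsing_inv, hR, psdSqrt_transpose, ← hR, Matrix.mul_assoc,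
    ← Matrix.mul_assoc Zᵀ, ← hRR, Matrix.mul_assoc, mul_nonsing_inv R hd, Matrix.mul_one,
    nonsing_inv_mul R hd]

/-- Rank–nullity leaves a kernel of dimension at least `d`. Together with the converse
`rank_le_of_mul_eq_zero`, this replaces the rank constraint by a closed condition on a pair of
matrices. -/
theorem exists_isometry_mul_eq_zero {m n d : ℕ} (A : Matrix (Fin m) (Fin n ⊕ Fin d) ℝ)
    (h : A.rank ≤ n) : ∃ X : Matrix (Fin n ⊕ Fin d) (Fin d) ℝ, Xᵀ * X = 1 ∧ A * X = 0 := by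
  have hk : d ≤ Module.finrank ℝ (LinearMap.ker A.mulVecLin) := by
    have := LinearMap.finrank_range_add_finrank_ker A.mulVecLin
    rw [Module.finrank_fintype_fun_eq_card, Fintype.card_sum, Fintype.card_fin,
      Fintype.card_fin] at this
    change A.rank + _ = _ at this
    omega
  obtain ⟨f, hf⟩ : ∃ f : Fin d → LinearMap.ker A.mulVecLin, LinearIndependent ℝ f :=
    ⟨_, (Module.finBasis ℝ (LinearMap.ker A.mulVecLin)).linearIndependent.comp _
      (Fin.castLE_injective hk)⟩
  have hf' : LinearIndependent ℝ fun i => (f i : Fin n ⊕ Fin d → ℝ) :=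
    hf.map' (LinearMap.ker A.mulVecLin).subtype (Submodule.ker_subtype _)
  set X : Matrix (Fin n ⊕ Fin d) (Fin d) ℝ := Matrix.of fun i j => (f j : Fin n ⊕ Fin d → ℝ) i
  have hX : X.rank = Fintype.card (Fin d) := by
    rw [← rank_transpose]
    exact LinearIndependent.rank_matrix (M := Xᵀ) hf'
  obtain ⟨T, hT, -⟩ := exists_mul_isometry hX
  refine ⟨X * T, hT, ?_⟩
  have : A * X = 0 := by
    ext i j
    exact congrFun (LinearMap.mem_ker.mp (f j).2) i
  rw [← Matrix.mul_assoc, this, Matrix.zero_mul]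

theorem rank_of_isometry {d : ℕ} {X : Matrix p (Fin d) ℝ} (h : Xᵀ * X = 1) : X.rank = d := by
  rw [← rank_transpose_mul_self, h, rank_one, Fintype.card_fin]

theorem rank_le_of_mul_eq_zero {m n d : ℕ} {A : Matrix (Fin m) (Fin n ⊕ Fin d) ℝ}
    {X : Matrix (Fin n ⊕ Fin d) (Fin d) ℝ} (hX : X.rank = d) (h : A * X = 0) : A.rank ≤ n := by
  have := rank_add_rank_le_card_of_mul_eq_zero h
  rw [hX, Fintype.card_sum, Fintype.card_fin, Fintype.card_fin] at this
  omega

/-! ### The pseudoinverse of the square root -/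

/-- Transposing the Penrose equations of a symmetric matrix permutes them, so uniqueness applies. -/
theorem pinv_transpose {A : Matrix q q ℝ} (hA : Aᵀ = A) : (pinv A)ᵀ = pinv A := by
  have h := isMoorePenrose_pinv A
  refine IsMoorePenrose.unique (A := A) ⟨?_, ?_, ?_, ?_⟩ h
  · have := congrArg transpose h.mul_mul_left
    simpa only [transpose_mul, hA, ← Matrix.mul_assoc] using this
  · have := congrArg transpose h.mul_mul_right
    simpa only [transpose_mul, hA, ← Matrix.mul_assoc] using this
  · have := h.symm_right
    rw [transpose_mul, hA] at this
    rw [this, ← this, transpose_mul, transpose_transpose, hA, this]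
  · have := h.symm_left
    rw [transpose_mul, hA] at this
    rw [this, ← this, transpose_mul, transpose_transpose, hA, this]

theorem pinv_mul_comm {A : Matrix q q ℝ} (hA : Aᵀ = A) : pinv A * A = A * pinv A := by
  have := (isMoorePenrose_pinv A).symm_left
  rwa [transpose_mul, hA, pinv_transpose hA] at this

variable [DecidableEq q] {S : Matrix q q ℝ}

theorem psdSqrt_mul_pinv (S : Matrix q q ℝ) :
    psdSqrt S * pinv (psdSqrt S) * psdSqrt S = psdSqrt S :=
  (isMoorePenrose_pinv _).mul_mul_left

theorem mul_pinv_psdSqrt (hS : S.PosSemidef) : S * pinv (psdSqrt S) = psdSqrt S := by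
  nth_rw 1 [← psdSqrt_mul_self hS]
  rw [Matrix.mul_assoc, ← pinv_mul_comm (psdSqrt_transpose S), ← Matrix.mul_assoc,
    psdSqrt_mul_pinv]

/-- By uniqueness the pseudoinverse of `S = R * R` is `pinv R * pinv R`; hence `S` and `R` have the
same range projector. -/
theorem mul_pinv_eq (hS : S.PosSemidef) : S * pinv S = pinv (psdSqrt S) * psdSqrt S := by
  set R := psdSqrt S with hR
  have hRt : Rᵀ = R := psdSqrt_transpose S
  have hRR : R * R = S := psdSqrt_mul_self hS
  have hc := pinv_mul_comm hRt
  have h := isMoorePenrose_pinv R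
  have e1 : S * (pinv R * pinv R) = R * pinv R := by
    rw [← Matrix.mul_assoc, mul_pinv_psdSqrt hS]
  have e2 : pinv R * pinv R * S = R * pinv R := by
    rw [← hRR, Matrix.mul_assoc, ← Matrix.mul_assoc (pinv R) R R, hc, h.mul_mul_left, hc]
  have : pinv S = pinv R * pinv R := by
    refine IsMoorePenrose.unique (isMoorePenrose_pinv S) ⟨?_, ?_, ?_, ?_⟩
    · rw [e1, ← hRR, ← Matrix.mul_assoc, h.mul_mul_left]
    · rw [e2, ← Matrix.mul_assoc, ← hc, h.mul_mul_right]
    · rw [e1, h.symm_left]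
    · rw [e2, h.symm_left]
  rw [this, e1, hc]

/-- Under the constraint, `D` is recovered from `D * pinv R`, the matrix whose norm is minimized. -/
theorem mul_one_sub_eq_zero_iff {p : Type*} (hS : S.PosSemidef) (D : Matrix p q ℝ) :
    D * (1 - S * pinv S) = 0 ↔ D * pinv (psdSqrt S) * psdSqrt S = D := by
  rw [mul_pinv_eq hS, Matrix.mul_sub, Matrix.mul_one, sub_eq_zero, Matrix.mul_assoc, eq_comm]

end LinearAlgebra

/-! ### Existence of minimizers and estimators. -/

section Existence

variable {n d m : ℕ} {S : Matrix (Fin n ⊕ Fin d) (Fin n ⊕ Fin d) ℝ}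

theorem psdSqrt_mul_isometry (hS : S.PosSemidef) {Y : Matrix (Fin n ⊕ Fin d) (Fin d) ℝ}
    (hY : Yᵀ * S * Y = 1) : (psdSqrt S * Y)ᵀ * (psdSqrt S * Y) = 1 := by
  rw [transpose_mul, psdSqrt_transpose, Matrix.mul_assoc, ← Matrix.mul_assoc (psdSqrt S),
    psdSqrt_mul_self hS, ← Matrix.mul_assoc, hY]

/-- This is the cheapest correction that annihilates the normalized directions `Y`; its cost, `‖C
Y‖²`, is computed in `frobSq_feasible_mul_pinv`. -/
theorem tlsFeasible_of_isometry (hS : S.PosSemidef) {Y : Matrix (Fin n ⊕ Fin d) (Fin d) ℝ}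
    (hY : Yᵀ * S * Y = 1) (C : Matrix (Fin m) (Fin n ⊕ Fin d) ℝ) :
    TLSFeasible S C (C * Y * Yᵀ * S) := by
  constructor
  · rw [mul_one_sub_eq_zero_iff hS, Matrix.mul_assoc _ S, mul_pinv_psdSqrt hS, Matrix.mul_assoc _
      (psdSqrt S), psdSqrt_mul_self hS]
  · refine rank_le_of_mul_eq_zero (X := Y) ?_ ?_
    · refine le_antisymm ((rank_le_card_width Y).trans_eq (Fintype.card_fin d)) ?_
      have := rank_mul_le_right (Yᵀ * S) Y
      rwa [hY, rank_one, Fintype.card_fin] at this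
    · rw [Matrix.sub_mul, Matrix.mul_assoc (C * Y), Matrix.mul_assoc (C * Y), hY, Matrix.mul_one,
        sub_self]

theorem frobSq_feasible_mul_pinv (hS : S.PosSemidef) {Y : Matrix (Fin n ⊕ Fin d) (Fin d) ℝ}
    (hY : Yᵀ * S * Y = 1) (C : Matrix (Fin m) (Fin n ⊕ Fin d) ℝ) :
    frobSq (C * Y * Yᵀ * S * pinv (psdSqrt S)) = frobSq (C * Y) := by
  rw [Matrix.mul_assoc _ S, mul_pinv_psdSqrt hS, Matrix.mul_assoc (C * Y)]
  have : Yᵀ * psdSqrt S = (psdSqrt S * Y)ᵀ := by rw [transpose_mul, psdSqrt_transpose]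
  rw [this, frobSq_mul_transpose_isometry (psdSqrt_mul_isometry hS hY)]

/-- The columns of a matrix `X` such that `R X` has full column rank, where `R` is the square root
of `S`, can be normalized. -/
theorem exists_isUnit_normalize (hS : S.PosSemidef) {X : Matrix (Fin n ⊕ Fin d) (Fin d) ℝ}
    (hX : (psdSqrt S * X).rank = d) :
    ∃ T K : Matrix (Fin d) (Fin d) ℝ, T * K = 1 ∧ K * T = 1 ∧ (X * T)ᵀ * S * (X * T) = 1 := by
  obtain ⟨T, hT, K, h1, h2⟩ := exists_mul_isometry (Z := psdSqrt S * X)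
    (by rw [hX, Fintype.card_fin])
  refine ⟨T, K, h1, h2, ?_⟩
  rw [Matrix.mul_assoc (psdSqrt S), transpose_mul (psdSqrt S), psdSqrt_transpose, Matrix.mul_assoc,
    ← Matrix.mul_assoc (psdSqrt S), psdSqrt_mul_self hS, ← Matrix.mul_assoc] at hT
  exact hT

theorem rank_psdSqrt_mul (hS : S.PosSemidef) {X : Matrix (Fin n ⊕ Fin d) (Fin d) ℝ}
    (hX : (S * X).rank = d) : (psdSqrt S * X).rank = d := by
  refine le_antisymm ((rank_le_card_width _).trans_eq (Fintype.card_fin d)) ?_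
  have := rank_mul_le_right (psdSqrt S) (psdSqrt S * X)
  rwa [← Matrix.mul_assoc, psdSqrt_mul_self hS, hX] at this

theorem continuous_frobSq {p q : Type*} [Fintype p] [Fintype q] :
    Continuous (frobSq : Matrix p q ℝ → ℝ) :=
  continuous_finsetSum _ fun i _ => continuous_finsetSum _ fun j _ =>
    (continuous_id.matrix_elem i j).pow 2

theorem isCompact_box {p q : Type*} (c : ℝ) :
    IsCompact {M : Matrix p q ℝ | ∀ i j, M i j ∈ Set.Icc (-c) c} := by
  have : IsCompact (Set.pi Set.univ fun _ : p => Set.pi Set.univ fun _ : q => Set.Icc (-c) c) :=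
    isCompact_univ_pi fun _ => isCompact_univ_pi fun _ => isCompact_Icc
  refine this.of_isClosed_subset ?_ fun M h i _ j _ => h i j
  have e : {M : Matrix p q ℝ | ∀ i j, M i j ∈ Set.Icc (-c) c} =
      ⋂ i, ⋂ j, {M : Matrix p q ℝ | M i j ∈ Set.Icc (-c) c} := by
    ext M; simp only [Set.mem_ofPred_eq, Set.mem_iInter]
  rw [e]
  exact isClosed_iInter fun i => isClosed_iInter fun j =>
    isClosed_Icc.preimage (continuous_id.matrix_elem i j)

theorem mem_box_of_frobSq_le {p q : Type*} [Fintype p] [Fintype q] {M : Matrix p q ℝ} {c : ℝ}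
    (h : frobSq M ≤ c) (i : p) (j : q) : M i j ∈ Set.Icc (-Real.sqrt c) (Real.sqrt c) :=
  abs_le.mp (Real.abs_le_sqrt ((sq_apply_le_frobSq M i j).trans h))

/-- Direct method: the cost is continuous, and pairs of a correction no costlier than a reference
`D0` and an orthonormal `d`-frame in the kernel form a compact set. -/
theorem exists_isTLSMinimizer (hS : S.PosSemidef) (X0 : Matrix (Fin n) (Fin d) ℝ)
    (hrank : (S * augment X0).rank = d) (C : Matrix (Fin m) (Fin n ⊕ Fin d) ℝ) :
    ∃ D, IsTLSMinimizer S C D := by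
  obtain ⟨T, -, -, -, hT⟩ := exists_isUnit_normalize hS (rank_psdSqrt_mul hS hrank)
  obtain ⟨D0, hD0⟩ : ∃ D, TLSFeasible S C D := ⟨_, tlsFeasible_of_isometry hS hT C⟩
  set R := psdSqrt S
  set c := frobSq (D0 * pinv R) with hc
  set K : Set (Matrix (Fin m) (Fin n ⊕ Fin d) ℝ × Matrix (Fin n ⊕ Fin d) (Fin d) ℝ) :=
    {P | P.1 * pinv R * R = P.1 ∧ (C - P.1) * P.2 = 0 ∧ P.2ᵀ * P.2 = 1 ∧
      frobSq (P.1 * pinv R) ≤ c} with hK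
  have hmem : ∀ D, TLSFeasible S C D → frobSq (D * pinv R) ≤ c → ∃ X, (D, X) ∈ K := by
    intro D hD hDc
    obtain ⟨X, hX1, hX2⟩ := exists_isometry_mul_eq_zero (C - D) hD.2
    exact ⟨X, (mul_one_sub_eq_zero_iff hS D).mp hD.1, hX2, hX1, hDc⟩
  have hfeas : ∀ P ∈ K, TLSFeasible S C P.1 := fun P hP =>
    ⟨(mul_one_sub_eq_zero_iff hS _).mpr hP.1, rank_le_of_mul_eq_zero (rank_of_isometry hP.2.2.1)
      hP.2.1⟩
  have hclosed : IsClosed K := by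
    have c1 : Continuous fun P : Matrix (Fin m) (Fin n ⊕ Fin d) ℝ ×
      Matrix (Fin n ⊕ Fin d) (Fin d) ℝ => P.1 := continuous_fst
    have c2 : Continuous fun P : Matrix (Fin m) (Fin n ⊕ Fin d) ℝ ×
      Matrix (Fin n ⊕ Fin d) (Fin d) ℝ => P.2 := continuous_snd
    have c3 := c1.matrix_mul (continuous_const (y := pinv R))
    refine (isClosed_eq (c3.matrix_mul continuous_const) c1).inter
      ((isClosed_eq ((continuous_const.sub c1).matrix_mul c2) continuous_const).inter
      ((isClosed_eq (c2.matrix_transpose.matrix_mul c2) continuous_const).inter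
      (isClosed_le (continuous_frobSq.comp c3) continuous_const)))
  have hcomp : IsCompact K := by
    refine ((isCompact_box (Real.sqrt (c * frobSq R))).prod
      (isCompact_box (Real.sqrt (Fintype.card (Fin d))))).of_isClosed_subset hclosed ?_
    rintro P ⟨h1, -, h3, h4⟩
    -- The cost alone bounds `D`, because `D = (D R†) R` on the feasible set.
    refine ⟨mem_box_of_frobSq_le ?_, mem_box_of_frobSq_le (frobSq_of_isometry h3).le⟩
    rw [← h1]
    exact (frobSq_mul_le _ _).trans (mul_le_mul_of_nonneg_right h4 (frobSq_nonneg _))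
  obtain ⟨X, hX⟩ := hmem D0 hD0 le_rfl
  obtain ⟨P, hP, hmin⟩ := hcomp.exists_isMinOn ⟨_, hX⟩
    (f := fun P => frobSq (P.1 * pinv R))
    (continuous_frobSq.comp (continuous_fst.matrix_mul continuous_const)).continuousOn
  refine ⟨P.1, hfeas P hP, fun D' hD' => ?_⟩
  rw [frobNorm_eq_sqrt, frobNorm_eq_sqrt]
  apply Real.sqrt_le_sqrt
  by_cases h : frobSq (D' * pinv R) ≤ c
  · obtain ⟨X', hX'⟩ := hmem D' hD' h
    exact isMinOn_iff.mp hmin (D', X') hX'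
  · exact hP.2.2.2.trans (not_le.mp h).le

theorem exists_isTLSEstimator (hS : S.PosSemidef) (X0 : Matrix (Fin n) (Fin d) ℝ)
    (hrank : (S * augment X0).rank = d) (C : Matrix (Fin m) (Fin n ⊕ Fin d) ℝ) :
    ∃ Xext Xhat, IsTLSEstimator S C Xext Xhat := by
  obtain ⟨D, hD⟩ := exists_isTLSMinimizer hS X0 hrank C
  obtain ⟨X, hX1, hX2⟩ := exists_isometry_mul_eq_zero (C - D) hD.1.2
  refine ⟨X, -(X.toRows₁ * X.toRows₂⁻¹), ⟨D, hD, hX2⟩, rank_of_isometry hX1, fun hu => ?_⟩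
  have hdet := (isUnit_iff_isUnit_det _).mp hu
  refine ⟨-X.toRows₂⁻¹, ?_, ?_⟩
  · rw [IsUnit.neg_iff, isUnit_iff_isUnit_det]
    exact isUnit_nonsing_inv_det _ hdet
  · nth_rw 1 [← fromRows_toRows X]
    rw [fromRows_mul, augment, Matrix.mul_neg, Matrix.mul_neg, mul_nonsing_inv _ hdet]

end Existence

/-! ### Deterministic perturbation bound. -/

section Perturbation

variable {n d : ℕ}

/-- The product of the upper part of `[I  X₀; 0  I]` with `X`: it vanishes on `augment X0`. -/
def residual {k : ℕ} (X0 : Matrix (Fin n) (Fin d) ℝ) (X : Matrix (Fin n ⊕ Fin d) (Fin k) ℝ) :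
    Matrix (Fin n) (Fin k) ℝ := X.toRows₁ + X0 * X.toRows₂

theorem residual_mul {k l : ℕ} (X0 : Matrix (Fin n) (Fin d) ℝ)
    (X : Matrix (Fin n ⊕ Fin d) (Fin k) ℝ) (T : Matrix (Fin k) (Fin l) ℝ) :
    residual X0 (X * T) = residual X0 X * T := by
  have h1 : (X * T).toRows₁ = X.toRows₁ * T := rfl
  have h2 : (X * T).toRows₂ = X.toRows₂ * T := rfl
  rw [residual, residual, h1, h2, Matrix.add_mul, Matrix.mul_assoc]

theorem residual_augment (X0 X : Matrix (Fin n) (Fin d) ℝ) :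
    residual X0 (augment X) = X - X0 := by
  rw [residual, augment, toRows₁_fromRows, toRows₂_fromRows, Matrix.mul_neg, Matrix.mul_one,
    ← sub_eq_add_neg]

/-- Splits `X` into a part carried by the residual and a part in the column space of `augment X0`.
-/
theorem eq_residual_sub {k : ℕ} (X0 : Matrix (Fin n) (Fin d) ℝ)
    (X : Matrix (Fin n ⊕ Fin d) (Fin k) ℝ) :
    X = fromRows (residual X0 X) (0 : Matrix (Fin d) (Fin k) ℝ) - augment X0 * X.toRows₂ := by
  rw [augment, fromRows_mul, Matrix.neg_mul, Matrix.one_mul, residual]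
  ext i j
  rcases i with i | i <;> simp

theorem frobSq_fromRows_zero {k : ℕ} (B : Matrix (Fin n) (Fin k) ℝ) :
    frobSq (fromRows B (0 : Matrix (Fin d) (Fin k) ℝ)) = frobSq B := by
  simp [frobSq, Fintype.sum_sum_type]

theorem frobSq_le_of_normalize {S : Matrix (Fin n ⊕ Fin d) (Fin n ⊕ Fin d) ℝ} (hS : S.PosSemidef)
    {X0 : Matrix (Fin n) (Fin d) ℝ} {T K : Matrix (Fin d) (Fin d) ℝ} (hTK : T * K = 1)
    (hT : (augment X0 * T)ᵀ * S * (augment X0 * T) = 1) {k : ℕ} (Z : Matrix (Fin d) (Fin k) ℝ) :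
    frobSq Z ≤ frobSq T * frobSq (psdSqrt S * (augment X0 * Z)) := by
  have h1 : T * (K * Z) = Z := by rw [← Matrix.mul_assoc, hTK, Matrix.one_mul]
  have h2 := frobSq_isometry_mul (psdSqrt_mul_isometry hS hT) (K * Z)
  have h3 : psdSqrt S * (augment X0 * T) * (K * Z) = psdSqrt S * (augment X0 * Z) := by
    rw [Matrix.mul_assoc, Matrix.mul_assoc, h1]
  rw [h3] at h2
  rw [h2]
  nth_rw 1 [← h1]
  exact frobSq_mul_le _ _

/-- Coercivity: where the residual vanishes, `X` lies in the column space of `augment X0`, on which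
`R` is bounded below. This controls directions that `R` alone does not see when `S` is singular. -/
theorem frobSq_le_residual {S : Matrix (Fin n ⊕ Fin d) (Fin n ⊕ Fin d) ℝ} (hS : S.PosSemidef)
    {X0 : Matrix (Fin n) (Fin d) ℝ} (hrank : (S * augment X0).rank = d) :
    ∃ K : ℝ, 0 ≤ K ∧ ∀ {k : ℕ} (X : Matrix (Fin n ⊕ Fin d) (Fin k) ℝ),
      frobSq X ≤ K * (frobSq (residual X0 X) + frobSq (psdSqrt S * X)) := by
  obtain ⟨T, T', hTT', -, hT⟩ := exists_isUnit_normalize hS (rank_psdSqrt_mul hS hrank)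
  set R := psdSqrt S
  have p1 := frobSq_nonneg T
  have p2 := frobSq_nonneg R
  have p3 := frobSq_nonneg (augment X0)
  refine ⟨2 + 4 * frobSq (augment X0) * frobSq T * (frobSq R + 1), by positivity, ?_⟩
  intro k X
  set B := residual X0 X
  set P : Matrix (Fin n ⊕ Fin d) (Fin k) ℝ := fromRows B 0
  have hX : X = P - augment X0 * X.toRows₂ := eq_residual_sub X0 X
  have hP : frobSq P = frobSq B := frobSq_fromRows_zero B
  have h1 : frobSq X ≤ 2 * frobSq B + 2 * (frobSq (augment X0) * frobSq X.toRows₂) := by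
    have := frobSq_sub_le P (augment X0 * X.toRows₂)
    rw [← hX, hP] at this
    linarith [frobSq_mul_le (augment X0) X.toRows₂]
  have h2 := frobSq_le_of_normalize hS hTT' hT X.toRows₂
  have h3 : R * (augment X0 * X.toRows₂) = R * P - R * X := by
    rw [← Matrix.mul_sub]; congr 1; rw [eq_sub_iff_add_eq, add_comm, ← eq_sub_iff_add_eq]; exact hX
  have h4 : frobSq (R * (augment X0 * X.toRows₂)) ≤ 2 * (frobSq R * frobSq B) +
      2 * frobSq (R * X) := by
    rw [h3]
    have := frobSq_sub_le (R * P) (R * X)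
    have h5 := frobSq_mul_le R P
    rw [hP] at h5
    linarith
  have q1 := frobSq_nonneg B
  have q2 := frobSq_nonneg (R * X)
  have h6 : frobSq X.toRows₂ ≤ frobSq T * (2 * (frobSq R * frobSq B) + 2 * frobSq (R * X)) :=
    h2.trans (mul_le_mul_of_nonneg_left h4 p1)
  have h7 := mul_le_mul_of_nonneg_left h6 p3
  have h8 : 0 ≤ frobSq (augment X0) * frobSq T * frobSq B := by positivity
  have h9 : 0 ≤ frobSq (augment X0) * frobSq T * frobSq R * frobSq (R * X) := by positivity
  nlinarith

/-- If the Gram matrix of the observations `C` is, up to a relative error `ε`, the sum of the Gram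
matrix of the true variables and of `M S`, then the total least squares estimator exists and its
squared error is of order `ε`. -/
theorem IsTLSEstimator.frobSq_sub_le {S : Matrix (Fin n ⊕ Fin d) (Fin n ⊕ Fin d) ℝ}
    (hS : S.PosSemidef) {X0 : Matrix (Fin n) (Fin d) ℝ} (hrank : (S * augment X0).rank = d) :
    ∃ κ : ℝ, 0 ≤ κ ∧ ∀ {m : ℕ} (C : Matrix (Fin m) (Fin n ⊕ Fin d) ℝ)
      (A : Matrix (Fin m) (Fin n) ℝ) (M lam ε : ℝ), 0 < lam → 0 ≤ ε → ε * κ ≤ 1 →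
      (∀ W : Matrix (Fin n) (Fin d) ℝ, lam * frobSq W ≤ frobSq (A * W)) →
      (∀ X : Matrix (Fin n ⊕ Fin d) (Fin d) ℝ,
        |frobSq (C * X) - frobSq (A * residual X0 X) - M * frobSq (psdSqrt S * X)| ≤
          ε * (frobSq (A * residual X0 X) + lam * frobSq X)) →
      ∀ Xext Xhat, IsTLSEstimator S C Xext Xhat →
        IsUnit Xext.toRows₂ ∧ frobSq (Xhat - X0) ≤ ε * κ := by
  obtain ⟨T, T', hTT', -, hT⟩ := exists_isUnit_normalize hS (rank_psdSqrt_mul hS hrank)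
  obtain ⟨K, hK0, hK⟩ := frobSq_le_residual hS hrank
  set R := psdSqrt S with hR
  set Y := augment X0 * T with hY
  have p1 := frobSq_nonneg R
  have p2 := frobSq_nonneg Y
  have p3 := frobSq_nonneg (R * augment X0)
  set G := frobSq Y + K * d with hG
  have hG0 : 0 ≤ G := by positivity
  -- With `ε κ ≤ 1`, the first summand gives `ε (1 + K) ≤ 1/2`, the second keeps the lower block
  -- invertible, and the third is the constant of the final estimate.
  refine ⟨2 * (1 + K) + 8 * frobSq R * G + 8 * frobSq (R * augment X0) * d * G, by positivity, ?_⟩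
  intro m C A M lam ε hlam hε hεκ hA hC Xext Xhat hest
  have hs0 : 0 ≤ ε * (8 * frobSq (R * augment X0) * d * G) := by positivity
  have hs1 : 0 ≤ ε * (8 * frobSq R * G) := by positivity
  have hs2 : 0 ≤ ε * (2 * (1 + K)) := by positivity
  have e1 : ε * (1 + K) ≤ 1 / 2 := by nlinarith
  have e2 : 2 * frobSq R * (2 * ε * G) ≤ 1 / 2 := by nlinarith
  obtain ⟨⟨D, hD, hker⟩, hXr, hnorm⟩ := hest
  have hDR : D * pinv R * R = D := (mul_one_sub_eq_zero_iff hS D).mp hD.1.1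
  have hCX : ∀ V : Matrix (Fin d) (Fin d) ℝ, C * (Xext * V) = D * pinv R * (R * (Xext * V)) := by
    intro V
    rw [← Matrix.mul_assoc _ R, hDR, ← sub_eq_zero, ← Matrix.sub_mul, ← Matrix.mul_assoc, hker,
      Matrix.zero_mul]
  -- If `R` killed a combination `Xext V`, so would `C`. The hypothesis on `C` and coercivity then
  -- give `‖A B‖² ≤ ½ ‖A B‖²` for its residual `B`, whence `Xext V = 0`, against the rank of `Xext`.
  have hrk : (R * Xext).rank = d := by
    by_contra hne
    obtain ⟨V, hV0, hV⟩ := exists_ne_zero_of_rank_ne_card (Z := R * Xext)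
      (by rwa [Fintype.card_fin])
    rw [Matrix.mul_assoc] at hV
    apply hV0
    apply eq_zero_of_rank_eq_card (Z := Xext) (by rw [hXr, Fintype.card_fin])
    apply eq_zero_of_frobSq_le_zero
    have h1 := hC (Xext * V)
    rw [hCX, hV, Matrix.mul_zero, frobSq_zero, frobSq_zero, mul_zero, sub_zero, zero_sub, abs_neg,
      abs_of_nonneg (frobSq_nonneg _)] at h1
    have h2 := hK (Xext * V)
    rw [hV, frobSq_zero, add_zero] at h2
    have h3 := hA (residual X0 (Xext * V))
    have h4 := frobSq_nonneg (residual X0 (Xext * V))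
    have h5 : ε * (lam * frobSq (Xext * V)) ≤ ε * K * frobSq (A * residual X0 (Xext * V)) := by
      calc ε * (lam * frobSq (Xext * V)) ≤
          ε * (lam * (K * frobSq (residual X0 (Xext * V)))) := by gcongr
        _ = ε * K * (lam * frobSq (residual X0 (Xext * V))) := by ring
        _ ≤ _ := by gcongr
    have h6 := frobSq_nonneg (A * residual X0 (Xext * V))
    have h7 : frobSq (A * residual X0 (Xext * V)) ≤ 0 := by nlinarith
    have h8 : frobSq (residual X0 (Xext * V)) ≤ 0 := by nlinarith
    nlinarith
  obtain ⟨U, U', hUU', hU'U, hU⟩ := exists_isUnit_normalize hS hrk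
  set X := Xext * U with hX
  have isoX := psdSqrt_mul_isometry hS hU
  have isoY := psdSqrt_mul_isometry hS hT
  -- `C X = (D R†)(R X)` with `R X` an isometry, so the cost of `D` dominates the left side; the
  -- competitor `C Y Yᵀ S` costs exactly the right side.
  have hmin : frobSq (C * X) ≤ frobSq (C * Y) := by
    have h1 := hD.2 _ (tlsFeasible_of_isometry hS hT C)
    rw [frobNorm_eq_sqrt, frobNorm_eq_sqrt, frobSq_feasible_mul_pinv hS hT,
      Real.sqrt_le_sqrt_iff (frobSq_nonneg _)] at h1
    rw [hX, hCX]
    exact (frobSq_mul_isometry_le isoX _).trans h1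
  set B := residual X0 X with hB
  -- Both normalized frames contribute the same `M * d`, and `Y` has zero residual; what remains is
  -- `(1 - ε (1 + K)) ‖A B‖² ≤ ε lam G`.
  have hBsmall : frobSq B ≤ 2 * ε * G := by
    have h1 := (abs_le.mp (hC X)).1
    have h2 := (abs_le.mp (hC Y)).2
    rw [frobSq_of_isometry isoX, Fintype.card_fin, ← hB] at h1
    have h3 : residual X0 Y = 0 := by
      rw [hY, residual_mul, residual_augment, sub_self, Matrix.zero_mul]
    rw [frobSq_of_isometry isoY, Fintype.card_fin, h3, Matrix.mul_zero, frobSq_zero] at h2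
    have h4 := hK X
    rw [frobSq_of_isometry isoX, Fintype.card_fin, ← hB] at h4
    have h5 := hA B
    have h6 := frobSq_nonneg (A * B)
    have h7 : ε * (lam * frobSq X) ≤ ε * K * frobSq (A * B) + ε * lam * (K * d) := by
      calc ε * (lam * frobSq X) ≤ ε * (lam * (K * (frobSq B + d))) := by gcongr
        _ = ε * K * (lam * frobSq B) + ε * lam * (K * d) := by ring
        _ ≤ _ := by gcongr
    have h8 : frobSq (A * B) ≤ lam * (2 * ε * G) := by
      rw [hG]
      nlinarith
    exact le_of_mul_le_mul_left (h5.trans h8) hlam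
  -- `‖V‖ = ‖R X V‖`; in the splitting of `X`, the residual part is at most `½ ‖V‖²` and is
  -- absorbed.
  have hinv : ∀ V : Matrix (Fin d) (Fin d) ℝ,
      frobSq V ≤ 4 * frobSq (R * augment X0) * frobSq (X.toRows₂ * V) := by
    intro V
    have h1 := frobSq_isometry_mul isoX V
    have h2 : psdSqrt S * X * V = R * fromRows B (0 : Matrix (Fin d) (Fin d) ℝ) * V -
        R * augment X0 * (X.toRows₂ * V) := by
      nth_rw 1 [eq_residual_sub X0 X]
      rw [Matrix.mul_sub, Matrix.sub_mul]
      simp only [Matrix.mul_assoc, hR, hB]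
    rw [h2] at h1
    have h3 := TLS.frobSq_sub_le (R * fromRows B (0 : Matrix (Fin d) (Fin d) ℝ) * V)
      (R * augment X0 * (X.toRows₂ * V))
    rw [h1] at h3
    have h4 := frobSq_mul_le (R * augment X0) (X.toRows₂ * V)
    have h5 := frobSq_mul_le (R * fromRows B (0 : Matrix (Fin d) (Fin d) ℝ)) V
    have h6 := frobSq_mul_le R (fromRows B (0 : Matrix (Fin d) (Fin d) ℝ))
    rw [frobSq_fromRows_zero] at h6
    have h7 := frobSq_nonneg V
    have h8 : 2 * (frobSq R * frobSq B) ≤ 1 / 2 := by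
      have := mul_le_mul_of_nonneg_left hBsmall p1
      linarith
    have h9 : 2 * frobSq (R * fromRows B (0 : Matrix (Fin d) (Fin d) ℝ)) * frobSq V ≤
        1 / 2 * frobSq V := mul_le_mul_of_nonneg_right (by linarith) h7
    linarith
  have hX2 : IsUnit X.toRows₂ := by
    refine isUnit_of_mul_eq_zero fun V hV => eq_zero_of_frobSq_le_zero ?_
    have := hinv V
    rwa [hV, frobSq_zero, mul_zero] at this
  have hXe2 : IsUnit Xext.toRows₂ := by
    have h1 : X.toRows₂ = Xext.toRows₂ * U := rfl
    rw [isUnit_iff_isUnit_det, h1, det_mul] at hX2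
    rw [isUnit_iff_isUnit_det]
    exact isUnit_of_mul_isUnit_left hX2
  refine ⟨hXe2, ?_⟩
  obtain ⟨V, -, hV⟩ := hnorm hXe2
  have h1 : X * (U' * V) = augment Xhat := by
    rw [hX, Matrix.mul_assoc, ← Matrix.mul_assoc U, hUU', Matrix.one_mul, hV]
  have h2 : Xhat - X0 = B * (U' * V) := by
    rw [← residual_augment, ← h1, residual_mul]
  have h3 : X.toRows₂ * (U' * V) = -1 := by
    have : (X * (U' * V)).toRows₂ = X.toRows₂ * (U' * V) := rfl
    rw [← this, h1, augment, toRows₂_fromRows]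
  have h4 := hinv (U' * V)
  rw [h3, frobSq_neg, frobSq_one, Fintype.card_fin] at h4
  calc frobSq (Xhat - X0) ≤ frobSq B * frobSq (U' * V) := by rw [h2]; exact frobSq_mul_le _ _
    _ ≤ (2 * ε * G) * (4 * frobSq (R * augment X0) * d) := by
        gcongr
        exact frobSq_nonneg _
    _ = ε * (8 * frobSq (R * augment X0) * d * G) := by ring
    _ ≤ _ := by nlinarith

end Perturbation

/-! ### Kronecker's lemma. -/

section Kronecker

/-- **Kronecker's lemma**. -/
theorem tendsto_sum_div_of_tendsto_sum {b x : ℕ → ℝ} (hb : Monotone b) (hpos : ∀ i, 0 < b i)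
    (hlim : Tendsto b atTop atTop) {c : ℝ}
    (hx : Tendsto (fun m => ∑ i ∈ Finset.range m, x i / b i) atTop (𝓝 c)) :
    Tendsto (fun m => (∑ i ∈ Finset.range m, x i) / b m) atTop (𝓝 0) := by
  set s : ℕ → ℝ := fun m => ∑ i ∈ Finset.range m, x i / b i with hs
  -- Summation by parts, with the partial sums `s` recentred at their limit `c`.
  have hsum : ∀ m, ∑ i ∈ Finset.range m, x i =
      b m * (s m - c) + b 0 * c - ∑ i ∈ Finset.range m, (b (i + 1) - b i) * (s (i + 1) - c) := by
    intro m
    induction m with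
    | zero => simp [hs]
    | succ m ih =>
      rw [Finset.sum_range_succ, Finset.sum_range_succ, ih]
      have h1 : s (m + 1) = s m + x m / b m := Finset.sum_range_succ _ _
      have h2 : x m = b m * (s (m + 1) - s m) := by
        rw [h1]; field_simp [(hpos m).ne']; ring
      rw [h2]; ring
  have htel : ∀ m, ∑ i ∈ Finset.range m, (b (i + 1) - b i) = b m - b 0 :=
    fun m => Finset.sum_range_sub b m
  have h0 : Tendsto (fun i => s (i + 1) - c) atTop (𝓝 0) := by
    simpa using (hx.comp (tendsto_add_atTop_nat 1)).sub_const c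
  -- Little-o of the nonnegative increments of `b` passes to partial sums because those telescope to
  -- infinity.
  have ho : (fun i => (b (i + 1) - b i) * (s (i + 1) - c)) =o[atTop]
      fun i => b (i + 1) - b i := by
    have := (Asymptotics.isBigO_refl (fun i => b (i + 1) - b i) atTop).mul_isLittleO
      ((Asymptotics.isLittleO_one_iff ℝ).mpr h0)
    simpa using this
  have htel' : Tendsto (fun m => ∑ i ∈ Finset.range m, (b (i + 1) - b i)) atTop atTop := by
    simp only [htel]
    simp only [sub_eq_add_neg]
    exact tendsto_atTop_add_const_right _ _ hlim
  have h1 := ho.sum_range (fun i => sub_nonneg.mpr (hb (Nat.le_succ i))) htel'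
  simp only [htel] at h1
  have hO : (fun m => b m - b 0) =O[atTop] b := by
    refine Asymptotics.IsBigO.of_bound 1 (Eventually.of_forall fun m => ?_)
    rw [Real.norm_of_nonneg (sub_nonneg.mpr (hb (Nat.zero_le m))),
      Real.norm_of_nonneg (hpos m).le]
    linarith [hpos 0]
  have h2 := (h1.trans_isBigO hO).tendsto_div_nhds_zero
  have h3 : Tendsto (fun m => s m - c) atTop (𝓝 0) := by simpa using hx.sub_const c
  have h4 : Tendsto (fun m => b 0 * c / b m) atTop (𝓝 0) := hlim.const_div_atTop _
  have h5 := (h3.add h4).sub h2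
  simp only [add_zero, sub_zero] at h5
  refine h5.congr fun m => ?_
  rw [hsum m]
  field_simp [(hpos m).ne']

end Kronecker

/-! ### Strong law and moment inequality. -/

section Probability

variable {Ω : Type*} [MeasurableSpace Ω] {μ : Measure Ω}

/-- By Tonelli the sum has finite expectation, hence is finite almost everywhere. -/
theorem ae_summable_of_summable_integral {f : ℕ → Ω → ℝ} (hint : ∀ i, Integrable (f i) μ)
    (h0 : ∀ i ω, 0 ≤ f i ω) (hs : Summable fun i => ∫ ω, f i ω ∂μ) :
    ∀ᵐ ω ∂μ, Summable fun i => f i ω := by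
  have h1 : ∫⁻ ω, ∑' i, ENNReal.ofReal (f i ω) ∂μ ≠ ⊤ := by
    rw [lintegral_tsum fun i => (hint i).aemeasurable.ennreal_ofReal]
    simp only [← ofReal_integral_eq_lintegral_ofReal (hint _) (ae_of_all _ (h0 _))]
    rw [← ENNReal.ofReal_tsum_of_nonneg (fun i => integral_nonneg (h0 i)) hs]
    exact ENNReal.ofReal_ne_top
  filter_upwards [ae_lt_top' (AEMeasurable.tsum fun i =>
    (hint i).aemeasurable.ennreal_ofReal) h1] with ω hω
  refine (ENNReal.summable_toReal hω.ne).congr fun i => ?_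
  rw [ENNReal.toReal_ofReal (h0 i ω)]

variable [IsProbabilityMeasure μ]

theorem integral_sum_sq_of_indep {X : ℕ → Ω → ℝ} (hind : iIndepFun X μ)
    (hX : ∀ i, MemLp (X i) 2 μ) (h0 : ∀ i, ∫ ω, X i ω ∂μ = 0) (k : ℕ) :
    ∫ ω, (∑ i ∈ Finset.range k, X i ω) ^ 2 ∂μ = ∑ i ∈ Finset.range k, ∫ ω, X i ω ^ 2 ∂μ := by
  have h1 := IndepFun.variance_sum (μ := μ) (X := X) (s := Finset.range k) (fun i _ => hX i)
    (fun i _ j _ hij => hind.indepFun hij)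
  have hm := (memLp_finsetSum' (Finset.range k) fun i _ => hX i).aestronglyMeasurable.aemeasurable
  rw [variance_of_integral_eq_zero hm] at h1
  · simp only [Finset.sum_apply] at h1
    rw [h1]
    exact Finset.sum_congr rfl fun i _ =>
      variance_of_integral_eq_zero (hX i).aestronglyMeasurable.aemeasurable (h0 i)
  · simp only [Finset.sum_apply]
    rw [integral_finsetSum _ fun i _ => (hX i).integrable (by norm_num)]
    exact Finset.sum_eq_zero fun i _ => h0 i

theorem abs_le_one_add_sq (x : ℝ) : |x| ≤ 1 + x ^ 2 := by
  nlinarith [sq_abs x, sq_nonneg (|x| - 1), abs_nonneg x]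

/-- A series of independent centred random variables with summable variances converges almost
surely. -/
theorem ae_exists_tendsto_sum_of_summable_sq {X : ℕ → Ω → ℝ} (hm : ∀ i, Measurable (X i))
    (hind : iIndepFun X μ) (hX : ∀ i, MemLp (X i) 2 μ) (h0 : ∀ i, ∫ ω, X i ω ∂μ = 0)
    (hs : Summable fun i => ∫ ω, X i ω ^ 2 ∂μ) :
    ∀ᵐ ω ∂μ, ∃ c, Tendsto (fun k => ∑ i ∈ Finset.range k, X i ω) atTop (𝓝 c) := by
  have hsm : ∀ i, StronglyMeasurable (X i) := fun i => (hm i).stronglyMeasurable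
  have hint : ∀ i, Integrable (X i) μ := fun i => (hX i).integrable (by norm_num)
  set F := Filtration.natural X hsm
  -- The shift includes `X k` in `M k`, matching the natural filtration, where `F k` is generated by
  -- `X 0, …, X k`.
  set M : ℕ → Ω → ℝ := fun k => ∑ i ∈ Finset.range (k + 1), X i with hM
  have hMint : ∀ k, Integrable (M k) μ := fun k => integrable_finsetSum' _ fun i _ => hint i
  have hadp : StronglyAdapted F M := by
    intro k
    refine Finset.stronglyMeasurable_sum _ fun i hi => ?_
    exact (Filtration.stronglyAdapted_natural hsm i).mono
      (F.mono (Nat.lt_succ_iff.mp (Finset.mem_range.mp hi)))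
  have hmart : Martingale M F μ := by
    refine martingale_nat hadp hMint fun k => ?_
    have e : M (k + 1) = M k + X (k + 1) := Finset.sum_range_succ _ _
    rw [e]
    filter_upwards [condExp_add (hMint k) (hint (k + 1)) (F k),
      hind.condExp_natural_ae_eq_of_lt hsm (Nat.lt_succ_self k)] with ω h1 h2
    rw [h1, Pi.add_apply, condExp_of_stronglyMeasurable (F.le k) (hadp k) (hMint k), h2,
      h0 (k + 1), add_zero]
  -- Orthogonality bounds the second moments, and `|x| ≤ 1 + x²` turns this into the `L¹` bound
  -- needed for martingale convergence.
  have hbdd : ∀ k, eLpNorm (M k) 1 μ ≤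
      (Real.toNNReal (1 + ∑' i, ∫ ω, X i ω ^ 2 ∂μ) : ENNReal) := by
    intro k
    rw [eLpNorm_one_eq_lintegral_enorm, ← ofReal_integral_norm_eq_lintegral_enorm (hMint k)]
    apply ENNReal.ofReal_le_ofReal
    have hM2 : MemLp (M k) 2 μ := memLp_finsetSum' _ fun i _ => hX i
    calc ∫ ω, ‖M k ω‖ ∂μ ≤ ∫ ω, (1 + M k ω ^ 2) ∂μ :=
          integral_mono (hMint k).norm ((integrable_const 1).add hM2.integrable_sq)
            fun ω => abs_le_one_add_sq _
      _ = 1 + ∑ i ∈ Finset.range (k + 1), ∫ ω, X i ω ^ 2 ∂μ := by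
          rw [integral_add (integrable_const 1) hM2.integrable_sq,
            ← integral_sum_sq_of_indep hind hX h0]
          simp [hM]
      _ ≤ _ := by
          gcongr
          exact hs.sum_le_tsum _ fun i _ => integral_nonneg fun ω => sq_nonneg _
  filter_upwards [hmart.submartingale.exists_ae_tendsto_of_bdd hbdd] with ω ⟨c, hc⟩
  refine ⟨c, (tendsto_add_atTop_iff_nat 1).mp ?_⟩
  simpa [hM] using hc

/-- The identity on `[-1, 1]`, and zero outside. -/
noncomputable def truncOne (x : ℝ) : ℝ := if |x| ≤ 1 then x else 0

theorem measurable_truncOne : Measurable truncOne :=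
  Measurable.ite (measurableSet_le measurable_id.abs measurable_const) measurable_id
    measurable_const

theorem abs_truncOne_le (x : ℝ) : |truncOne x| ≤ 1 := by
  unfold truncOne; split_ifs with h
  · exact h
  · simp

/-- Below level one `x² ≤ |x|ʳ` because `r ≤ 2`; above it `|x| ≤ |x|ʳ` because `1 ≤ r`. So the
`r`-th moment controls both the variance of the truncation and, in `abs_sub_truncOne_le`, the mean
of the remainder. -/
theorem truncOne_sq_le {r : ℝ} (hr1 : 1 ≤ r) (hr2 : r ≤ 2) (x : ℝ) : truncOne x ^ 2 ≤ |x| ^ r := by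
  unfold truncOne; split_ifs with h
  · rw [← sq_abs, ← Real.rpow_two]
    exact Real.rpow_le_rpow_of_exponent_ge' (abs_nonneg x) h (by linarith) hr2
  · simpa using Real.rpow_nonneg (abs_nonneg x) r

theorem abs_sub_truncOne_le {r : ℝ} (hr1 : 1 ≤ r) (x : ℝ) : |x - truncOne x| ≤ |x| ^ r := by
  unfold truncOne; split_ifs with h
  · simpa using Real.rpow_nonneg (abs_nonneg x) r
  · rw [sub_zero]
    exact Real.self_le_rpow_of_one_le (not_le.mp h).le hr1

theorem abs_le_one_add_rpow {r : ℝ} (hr1 : 1 ≤ r) (x : ℝ) : |x| ≤ 1 + |x| ^ r := by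
  rcases le_total |x| 1 with h | h
  · linarith [Real.rpow_nonneg (abs_nonneg x) r]
  · linarith [Real.self_le_rpow_of_one_le h hr1]

/-- A strong law of large numbers for independent centred random variables with bounded moments of
order `r`, where `1 ≤ r ≤ 2`. -/
theorem ae_tendsto_sum_div {ξ : ℕ → Ω → ℝ} (hm : ∀ i, Measurable (ξ i)) (hind : iIndepFun ξ μ)
    {r K : ℝ} (hr1 : 1 ≤ r) (hr2 : r ≤ 2) (hint : ∀ i, Integrable (fun ω => |ξ i ω| ^ r) μ)
    (hK : ∀ i, ∫ ω, |ξ i ω| ^ r ∂μ ≤ K) (h0 : ∀ i, ∫ ω, ξ i ω ∂μ = 0)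
    {b : ℕ → ℝ} (hb : Monotone b) (hpos : ∀ i, 0 < b i) (hlim : Tendsto b atTop atTop)
    (hs : Summable fun i => 1 / b i ^ r) :
    ∀ᵐ ω ∂μ, Tendsto (fun m => (∑ i ∈ Finset.range m, ξ i ω) / b m) atTop (𝓝 0) := by
  set η : ℕ → Ω → ℝ := fun i ω => ξ i ω / b i with hη
  have hηm : ∀ i, Measurable (η i) := fun i => (hm i).div_const _
  have hηr : ∀ i, (fun ω => |η i ω| ^ r) = fun ω => |ξ i ω| ^ r * (1 / b i ^ r) := by
    intro i; funext ω
    rw [hη]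
    simp only [abs_div, abs_of_pos (hpos i)]
    rw [Real.div_rpow (abs_nonneg _) (hpos i).le, div_eq_mul_one_div]
  have hηint : ∀ i, Integrable (fun ω => |η i ω| ^ r) μ := fun i => by
    rw [hηr]; exact (hint i).mul_const _
  have hηK : ∀ i, ∫ ω, |η i ω| ^ r ∂μ ≤ K * (1 / b i ^ r) := fun i => by
    rw [hηr, integral_mul_const]
    exact mul_le_mul_of_nonneg_right (hK i) (by have := hpos i; positivity)
  have hηsum : Summable fun i => ∫ ω, |η i ω| ^ r ∂μ :=
    Summable.of_nonneg_of_le (fun i => integral_nonneg fun ω => by positivity) hηK (hs.mul_left K)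
  have hη1 : ∀ i, Integrable (η i) μ := fun i =>
    Integrable.mono' ((integrable_const 1).add (hηint i)) (hηm i).aestronglyMeasurable
      (ae_of_all _ fun ω => abs_le_one_add_rpow hr1 _)
  have hη0 : ∀ i, ∫ ω, η i ω ∂μ = 0 := fun i => by
    simp only [hη]; rw [integral_div, h0, zero_div]
  set g : ℕ → Ω → ℝ := fun i ω => truncOne (η i ω) with hg
  have hgm : ∀ i, Measurable (g i) := fun i => measurable_truncOne.comp (hηm i)
  have hg2 : ∀ i, MemLp (g i) 2 μ := fun i =>
    MemLp.of_bound (hgm i).aestronglyMeasurable 1 (ae_of_all _ fun ω => abs_truncOne_le _)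
  have hg1 : ∀ i, Integrable (g i) μ := fun i => (hg2 i).integrable (by norm_num)
  have hdint : ∀ i, Integrable (fun ω => |η i ω - g i ω|) μ := fun i =>
    ((hη1 i).sub (hg1 i)).abs
  have hdle : ∀ i, ∫ ω, |η i ω - g i ω| ∂μ ≤ ∫ ω, |η i ω| ^ r ∂μ := fun i =>
    integral_mono (hdint i) (hηint i) fun ω => abs_sub_truncOne_le hr1 _
  have hdsum : Summable fun i => ∫ ω, |η i ω - g i ω| ∂μ :=
    Summable.of_nonneg_of_le (fun i => integral_nonneg fun ω => abs_nonneg _) hdle hηsum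
  have hd := ae_summable_of_summable_integral hdint (fun i ω => abs_nonneg _) hdsum
  -- As `η i` is centred, the mean of its truncation is minus that of the discarded part.
  have hgmean : Summable fun i => ∫ ω, g i ω ∂μ := by
    refine Summable.of_norm_bounded hdsum fun i => ?_
    have : ∫ ω, g i ω ∂μ = -∫ ω, (η i ω - g i ω) ∂μ := by
      rw [integral_sub (hη1 i) (hg1 i), hη0]; ring
    rw [this, norm_neg]
    exact norm_integral_le_integral_norm _
  set h : ℕ → Ω → ℝ := fun i ω => g i ω - ∫ ω', g i ω' ∂μ with hh
  have hh2 : ∀ i, MemLp (h i) 2 μ := fun i => (hg2 i).sub (memLp_const _)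
  have hh0 : ∀ i, ∫ ω, h i ω ∂μ = 0 := fun i => by
    simp only [hh]
    rw [integral_sub (hg1 i) (integrable_const _)]; simp
  have hhind : iIndepFun h μ := by
    have := hind.comp (fun i x => truncOne (x / b i) - ∫ ω', g i ω' ∂μ) fun i =>
      (measurable_truncOne.comp (measurable_id.div_const _)).sub_const _
    exact this
  have hhsum : Summable fun i => ∫ ω, h i ω ^ 2 ∂μ := by
    refine Summable.of_nonneg_of_le (fun i => integral_nonneg fun ω => sq_nonneg _) (fun i => ?_)
      hηsum
    calc ∫ ω, h i ω ^ 2 ∂μ = variance (g i) μ :=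
          (variance_eq_integral (hgm i).aemeasurable).symm
      _ ≤ ∫ ω, (g i ^ 2) ω ∂μ := variance_le_expectation_sq (hgm i).aestronglyMeasurable
      _ ≤ ∫ ω, |η i ω| ^ r ∂μ :=
          integral_mono (hg2 i).integrable_sq (hηint i) fun ω => truncOne_sq_le hr1 hr2 _
  have hconv := ae_exists_tendsto_sum_of_summable_sq (fun i => (hgm i).sub_const _) hhind hh2 hh0
    hhsum
  filter_upwards [hd, hconv] with ω hω1 ⟨c, hc⟩
  have h1 := (hω1.of_abs).hasSum.tendsto_sum_nat
  have h2 := hgmean.hasSum.tendsto_sum_nat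
  -- `η = h + E g + (η - g)`: three convergent series, after which Kronecker's lemma applies.
  refine tendsto_sum_div_of_tendsto_sum hb hpos hlim (((hc.add h2).add h1).congr fun m => ?_)
  rw [← Finset.sum_add_distrib, ← Finset.sum_add_distrib]
  refine Finset.sum_congr rfl fun i _ => ?_
  simp only [hη]
  ring

/-! ### Moments of linear combinations -/

/-- Bernoulli's inequality for the exponent `r - 1 ∈ [0, 1]`, multiplied by `1 + t`. -/
theorem one_add_rpow_le {r t : ℝ} (hr1 : 1 ≤ r) (hr2 : r ≤ 2) (ht : -1 ≤ t) :
    (1 + t) ^ r ≤ 1 + r * t + t ^ 2 := by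
  have h1 : (1 + t) ^ (r - 1) ≤ 1 + (r - 1) * t :=
    rpow_one_add_le_one_add_mul_self ht (by linarith) (by linarith)
  have h0 : 0 ≤ 1 + t := by linarith
  have h2 : (1 + t) ^ r = (1 + t) * (1 + t) ^ (r - 1) := by
    rcases h0.eq_or_lt with h | h
    · rw [← h, zero_mul, Real.zero_rpow (by linarith)]
    · rw [mul_comm, ← Real.rpow_add_one h.ne', sub_add_cancel]
  rw [h2]
  have := mul_le_mul_of_nonneg_left h1 h0
  nlinarith [sq_nonneg t]

/-- The term linear in `b` is kept exactly, since it integrates to zero when `b` is centred and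
independent of `a`. For `|a| < |b|` everything is dominated by powers of `b` (constants 16 and 4);
otherwise the square is expanded around `a ^ 2`. The constant 20 is not sharp. -/
theorem sq_add_rpow_le {r : ℝ} (hr1 : 1 ≤ r) (hr2 : r ≤ 2) (a b : ℝ) :
    ((a + b) ^ 2) ^ r ≤ (a ^ 2) ^ r + 2 * r * ((a ^ 2) ^ (r - 1) * a * b) +
      20 * ((a ^ 2) ^ (r - 1) * b ^ 2 + (b ^ 2) ^ r) := by
  have hw : 0 ≤ (a ^ 2) ^ (r - 1) := by positivity
  have hv : 0 ≤ (b ^ 2) ^ r := by positivity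
  have hu : 0 ≤ (a ^ 2) ^ r := by positivity
  rcases lt_or_ge |a| |b| with h | h
  · have h1 : ((a + b) ^ 2) ^ r ≤ 16 * (b ^ 2) ^ r := by
      have h2 : (a + b) ^ 2 ≤ 4 * b ^ 2 := by
        rw [← sq_abs (a + b), ← sq_abs b]
        have := abs_add_le a b
        nlinarith [abs_nonneg (a + b)]
      calc ((a + b) ^ 2) ^ r ≤ (4 * b ^ 2) ^ r := by gcongr
        _ = 4 ^ r * (b ^ 2) ^ r := Real.mul_rpow (by norm_num) (sq_nonneg b)
        _ ≤ 4 ^ (2 : ℝ) * (b ^ 2) ^ r := by gcongr; norm_num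
        _ = _ := by norm_num
    have h3 : -(a * b) ≤ b ^ 2 := by
      have : |a * b| ≤ b ^ 2 := by
        rw [abs_mul, ← sq_abs b]; nlinarith [abs_nonneg b]
      linarith [neg_abs_le (a * b)]
    have h4 := mul_le_mul_of_nonneg_left h3 hw
    have h5 : 0 ≤ (a ^ 2) ^ (r - 1) * b ^ 2 := by positivity
    nlinarith
  · by_cases ha : a = 0
    · have hb : b = 0 := by simpa [ha] using h
      subst ha hb
      simp only [mul_zero, add_zero]
      linarith
    have ha2 : 0 < a ^ 2 := by positivity
    set t := (2 * a * b + b ^ 2) / a ^ 2 with ht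
    have hat : a ^ 2 * t = 2 * a * b + b ^ 2 := by rw [ht]; field_simp
    have h1 : (a + b) ^ 2 = a ^ 2 * (1 + t) := by rw [mul_add, hat]; ring
    have h2 : 0 ≤ 1 + t := by
      by_contra hneg
      have : a ^ 2 * (1 + t) < 0 := mul_neg_of_pos_of_neg ha2 (not_le.mp hneg)
      rw [← h1] at this
      linarith [sq_nonneg (a + b)]
    have h3 := one_add_rpow_le hr1 hr2 (by linarith : -1 ≤ t)
    have h4 : (a ^ 2) ^ r = (a ^ 2) ^ (r - 1) * a ^ 2 := by
      rw [← Real.rpow_add_one ha2.ne', sub_add_cancel]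
    have h5 : a ^ 2 * t ^ 2 ≤ 9 * b ^ 2 := by
      have e1 : a ^ 2 * (a ^ 2 * t ^ 2) = (2 * a * b + b ^ 2) ^ 2 := by rw [← hat]; ring
      have e2 : (2 * a * b + b ^ 2) ^ 2 ≤ a ^ 2 * (9 * b ^ 2) := by
        have : (2 * a + b) ^ 2 ≤ 9 * a ^ 2 := by
          rw [← sq_abs (2 * a + b), ← sq_abs a]
          have := abs_add_le (2 * a) b
          rw [abs_mul, abs_two] at this
          nlinarith [abs_nonneg (2 * a + b)]
        nlinarith [sq_nonneg b]
      exact le_of_mul_le_mul_left (e1.trans_le e2) ha2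
    rw [h1, Real.mul_rpow ha2.le h2, h4]
    have h6 : (a ^ 2) ^ (r - 1) * a ^ 2 * (1 + t) ^ r ≤
        (a ^ 2) ^ (r - 1) * (a ^ 2 + r * (2 * a * b + b ^ 2) + 9 * b ^ 2) := by
      rw [mul_assoc]
      refine mul_le_mul_of_nonneg_left ?_ hw
      have := mul_le_mul_of_nonneg_left h3 ha2.le
      nlinarith
    have h7 : r * ((a ^ 2) ^ (r - 1) * b ^ 2) ≤ 2 * ((a ^ 2) ^ (r - 1) * b ^ 2) := by gcongr
    have h8 : 0 ≤ (a ^ 2) ^ (r - 1) * b ^ 2 := by positivity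
    nlinarith

theorem le_one_add_rpow {x s : ℝ} (hx : 0 ≤ x) (hs : 1 ≤ s) : x ≤ 1 + x ^ s := by
  simpa [abs_of_nonneg hx] using abs_le_one_add_rpow hs x

theorem rpow_le_one_add {x s : ℝ} (hx : 0 ≤ x) (hs0 : 0 ≤ s) (hs1 : s ≤ 1) : x ^ s ≤ 1 + x := by
  rcases le_total x 1 with h | h
  · linarith [Real.rpow_le_one hx h hs0]
  · have := Real.rpow_le_rpow_of_exponent_le h hs1
    rw [Real.rpow_one] at this
    linarith

theorem memLp_two_of_integrable_sq_rpow {X : Ω → ℝ} (hm : Measurable X) {r : ℝ} (hr1 : 1 ≤ r)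
    (hint : Integrable (fun ω => (X ω ^ 2) ^ r) μ) : MemLp X 2 μ := by
  rw [memLp_two_iff_integrable_sq hm.aestronglyMeasurable]
  refine Integrable.mono' ((integrable_const 1).add hint) (hm.pow_const 2).aestronglyMeasurable
    (ae_of_all _ fun ω => ?_)
  rw [Real.norm_of_nonneg (sq_nonneg _)]
  exact le_one_add_rpow (sq_nonneg _) hr1

/-- A moment inequality of Rosenthal type: linear combinations, with coefficients of square sum at
most one, of independent centred random variables with bounded moments of order `2 r` have bounded
moments of order `2 r`. -/
theorem integral_sum_mul_sq_rpow_le {X : ℕ → Ω → ℝ} (hm : ∀ i, Measurable (X i))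
    (hind : iIndepFun X μ) {r K : ℝ} (hr1 : 1 ≤ r) (hr2 : r ≤ 2)
    (hint : ∀ i, Integrable (fun ω => (X i ω ^ 2) ^ r) μ)
    (hK : ∀ i, ∫ ω, (X i ω ^ 2) ^ r ∂μ ≤ K) (h0 : ∀ i, ∫ ω, X i ω ∂μ = 0)
    (u : ℕ → ℝ) (k : ℕ) (hu : ∑ i ∈ Finset.range k, u i ^ 2 ≤ 1) :
    Integrable (fun ω => ((∑ i ∈ Finset.range k, u i * X i ω) ^ 2) ^ r) μ ∧
      ∫ ω, ((∑ i ∈ Finset.range k, u i * X i ω) ^ 2) ^ r ∂μ ≤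
        20 * ((2 + K) * (1 + K) + K) * ∑ i ∈ Finset.range k, u i ^ 2 := by
  have hK0 : 0 ≤ K := le_trans (integral_nonneg fun ω => by positivity) (hK 0)
  set Y : ℕ → Ω → ℝ := fun i ω => u i * X i ω with hY
  have hYm : ∀ i, Measurable (Y i) := fun i => (hm i).const_mul _
  have hX2 : ∀ i, MemLp (X i) 2 μ := fun i => memLp_two_of_integrable_sq_rpow (hm i) hr1 (hint i)
  have hY2 : ∀ i, MemLp (Y i) 2 μ := fun i => (hX2 i).const_mul _
  have hY1 : ∀ i, Integrable (Y i) μ := fun i => (hY2 i).integrable (by norm_num)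
  have hY0 : ∀ i, ∫ ω, Y i ω ∂μ = 0 := fun i => by
    simp only [hY]; rw [integral_const_mul, h0, mul_zero]
  have hYind : iIndepFun Y μ :=
    hind.comp (fun i x => u i * x) fun i => measurable_const.mul measurable_id
  have hYsq : ∀ i, ∫ ω, Y i ω ^ 2 ∂μ ≤ (1 + K) * u i ^ 2 := fun i => by
    simp only [hY, mul_pow]
    rw [integral_const_mul, mul_comm]
    refine mul_le_mul_of_nonneg_right ?_ (sq_nonneg _)
    calc ∫ ω, X i ω ^ 2 ∂μ ≤ ∫ ω, (1 + (X i ω ^ 2) ^ r) ∂μ :=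
          integral_mono (hX2 i).integrable_sq ((integrable_const 1).add (hint i))
            fun ω => le_one_add_rpow (sq_nonneg _) hr1
      _ = 1 + ∫ ω, (X i ω ^ 2) ^ r ∂μ := by
          rw [integral_add (integrable_const 1) (hint i)]; simp
      _ ≤ 1 + K := by linarith [hK i]
  have hYr : ∀ i, (fun ω => (Y i ω ^ 2) ^ r) = fun ω => (u i ^ 2) ^ r * (X i ω ^ 2) ^ r := by
    intro i; funext ω
    simp only [hY, mul_pow]
    exact Real.mul_rpow (sq_nonneg _) (sq_nonneg _)
  have hYrint : ∀ i, Integrable (fun ω => (Y i ω ^ 2) ^ r) μ := fun i => by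
    rw [hYr]; exact (hint i).const_mul _
  -- The bound is proportional to `∑ u i ^ 2` rather than constant, so that the induction closes:
  -- adding index `k` costs at most `20 * A * u k ^ 2`.
  set A : ℝ := (2 + K) * (1 + K) + K
  induction k with
  | zero =>
    have hz : ((0 : ℝ) ^ 2) ^ r = 0 := by
      rw [zero_pow two_ne_zero, Real.zero_rpow (by linarith)]
    simp only [Finset.range_zero, Finset.sum_empty, hz]
    simp
  | succ k ih =>
    rw [Finset.sum_range_succ] at hu
    have hk1 : ∑ i ∈ Finset.range k, u i ^ 2 ≤ 1 := by linarith [sq_nonneg (u k)]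
    have huk : u k ^ 2 ≤ 1 := by
      linarith [Finset.sum_nonneg fun i (_ : i ∈ Finset.range k) => sq_nonneg (u i)]
    obtain ⟨ih1, ih2⟩ := ih hk1
    set Z : Ω → ℝ := fun ω => ∑ i ∈ Finset.range k, Y i ω with hZ
    change Integrable (fun ω => (Z ω ^ 2) ^ r) μ at ih1
    change ∫ ω, (Z ω ^ 2) ^ r ∂μ ≤ _ at ih2
    have hZm : Measurable Z := Finset.measurable_fun_sum _ fun i _ => hYm i
    have hZY : IndepFun Z (Y k) μ := by
      have := hYind.indepFun_finsetSum_of_notMem hYm (s := Finset.range k) (i := k) (by simp)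
      convert this using 1
      ext ω; simp [hZ]
    have hZ2 : MemLp Z 2 μ := memLp_two_of_integrable_sq_rpow hZm hr1 ih1
    have hYrle : ∫ ω, (Y k ω ^ 2) ^ r ∂μ ≤ K * u k ^ 2 := by
      rw [hYr, integral_const_mul, mul_comm]
      refine mul_le_mul (hK k) ?_ (by positivity) hK0
      simpa using Real.rpow_le_rpow_of_exponent_ge' (sq_nonneg (u k)) huk zero_le_one hr1
    -- Since `r - 1 ∈ [0, 1]`, the mean of this weight needs only the second moment of `Z`, which
    -- orthogonality bounds by `1 + K`.
    set W : Ω → ℝ := fun ω => (Z ω ^ 2) ^ (r - 1) with hW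
    have hWm : Measurable W := (hZm.pow_const 2).pow_const _
    have hWle : ∀ ω, W ω ≤ 1 + Z ω ^ 2 := fun ω =>
      rpow_le_one_add (sq_nonneg _) (by linarith) (by linarith)
    have hW0 : ∀ ω, 0 ≤ W ω := fun ω => by positivity
    have hWint : Integrable W μ :=
      Integrable.mono' ((integrable_const 1).add hZ2.integrable_sq) hWm.aestronglyMeasurable
        (ae_of_all _ fun ω => by rw [Real.norm_of_nonneg (hW0 ω)]; exact hWle ω)
    have hWK : ∫ ω, W ω ∂μ ≤ 2 + K := by
      calc ∫ ω, W ω ∂μ ≤ ∫ ω, (1 + Z ω ^ 2) ∂μ :=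
            integral_mono hWint ((integrable_const 1).add hZ2.integrable_sq) hWle
        _ = 1 + ∑ i ∈ Finset.range k, ∫ ω, Y i ω ^ 2 ∂μ := by
            rw [integral_add (integrable_const 1) hZ2.integrable_sq,
              ← integral_sum_sq_of_indep hYind hY2 hY0]
            simp [hZ]
        _ ≤ 1 + ∑ i ∈ Finset.range k, (1 + K) * u i ^ 2 := by
            gcongr with i
            exact hYsq i
        _ ≤ 2 + K := by
            rw [← Finset.mul_sum]
            nlinarith
    have hWZm : Measurable fun ω => W ω * Z ω := hWm.mul hZm
    have hWZint : Integrable (fun ω => W ω * Z ω) μ := by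
      refine Integrable.mono' (((integrable_const 1).add hZ2.integrable_sq).add ih1)
        hWZm.aestronglyMeasurable (ae_of_all _ fun ω => ?_)
      have e : (Z ω ^ 2) ^ r = W ω * Z ω ^ 2 := by
        by_cases hz : Z ω = 0
        · simp only [hz, zero_pow two_ne_zero, mul_zero]
          rw [Real.zero_rpow (by linarith)]
        · rw [hW]
          simp only
          rw [← Real.rpow_add_one (by positivity), sub_add_cancel]
      have := abs_le_one_add_sq (Z ω)
      rw [Real.norm_eq_abs, abs_mul, abs_of_nonneg (hW0 ω)]
      change _ ≤ 1 + Z ω ^ 2 + (Z ω ^ 2) ^ r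
      rw [e]
      calc W ω * |Z ω| ≤ W ω * (1 + Z ω ^ 2) := mul_le_mul_of_nonneg_left this (hW0 ω)
        _ ≤ _ := by linarith [hWle ω]
    have hi1 : IndepFun (fun ω => W ω * Z ω) (Y k) μ :=
      hZY.comp (φ := fun z => (z ^ 2) ^ (r - 1) * z) (ψ := id)
        (((measurable_id.pow_const 2).pow_const _).mul measurable_id) measurable_id
    have hi2 : IndepFun W (fun ω => Y k ω ^ 2) μ :=
      hZY.comp (φ := fun z => (z ^ 2) ^ (r - 1)) (ψ := fun z => z ^ 2)
        ((measurable_id.pow_const 2).pow_const _) (measurable_id.pow_const 2)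
    have hc1 : Integrable (fun ω => W ω * Z ω * Y k ω) μ := hi1.integrable_mul hWZint (hY1 k)
    have hc2 : Integrable (fun ω => W ω * Y k ω ^ 2) μ :=
      hi2.integrable_mul hWint (hY2 k).integrable_sq
    have hv1 : ∫ ω, W ω * Z ω * Y k ω ∂μ = 0 := by
      have := hi1.integral_mul_eq_mul_integral hWZm.aestronglyMeasurable
        (hYm k).aestronglyMeasurable
      rw [hY0, mul_zero] at this
      exact this
    have hv2 : ∫ ω, W ω * Y k ω ^ 2 ∂μ ≤ (2 + K) * ((1 + K) * u k ^ 2) := by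
      have := hi2.integral_mul_eq_mul_integral hWm.aestronglyMeasurable
        ((hYm k).pow_const 2).aestronglyMeasurable
      refine (le_of_eq this).trans (mul_le_mul hWK (hYsq k) ?_ (by positivity))
      exact integral_nonneg fun ω => sq_nonneg _
    have hpt : ∀ ω, ((Z ω + Y k ω) ^ 2) ^ r ≤ (Z ω ^ 2) ^ r + 2 * r * (W ω * Z ω * Y k ω) +
        20 * (W ω * Y k ω ^ 2 + (Y k ω ^ 2) ^ r) := fun ω => sq_add_rpow_le hr1 hr2 _ _
    have hI1 : Integrable (fun ω => (Z ω ^ 2) ^ r + 2 * r * (W ω * Z ω * Y k ω)) μ :=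
      ih1.add (hc1.const_mul _)
    have hI2 : Integrable (fun ω => 20 * (W ω * Y k ω ^ 2 + (Y k ω ^ 2) ^ r)) μ :=
      (hc2.add (hYrint k)).const_mul _
    have e : (fun ω => ((∑ i ∈ Finset.range (k + 1), u i * X i ω) ^ 2) ^ r) =
        fun ω => ((Z ω + Y k ω) ^ 2) ^ r := by
      funext ω; rw [Finset.sum_range_succ]
    have hI : Integrable (fun ω => ((Z ω + Y k ω) ^ 2) ^ r) μ :=
      Integrable.mono' (hI1.add hI2)
        ((((hZm.add (hYm k)).pow_const 2).pow_const r).aestronglyMeasurable)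
        (ae_of_all _ fun ω => by
          rw [Real.norm_of_nonneg (by positivity)]
          exact hpt ω)
    rw [e]
    refine ⟨hI, ?_⟩
    calc ∫ ω, ((Z ω + Y k ω) ^ 2) ^ r ∂μ ≤ ∫ ω, ((Z ω ^ 2) ^ r + 2 * r * (W ω * Z ω * Y k ω) +
          20 * (W ω * Y k ω ^ 2 + (Y k ω ^ 2) ^ r)) ∂μ := integral_mono hI (hI1.add hI2) hpt
      _ = ∫ ω, (Z ω ^ 2) ^ r ∂μ + 2 * r * 0 +
          20 * (∫ ω, W ω * Y k ω ^ 2 ∂μ + ∫ ω, (Y k ω ^ 2) ^ r ∂μ) := by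
          rw [integral_add hI1 hI2, integral_add ih1 (hc1.const_mul _), integral_const_mul,
            integral_const_mul, integral_add hc2 (hYrint k), hv1]
      _ ≤ 20 * A * ∑ i ∈ Finset.range k, u i ^ 2 + 2 * r * 0 +
          20 * ((2 + K) * ((1 + K) * u k ^ 2) + K * u k ^ 2) := by gcongr
      _ = _ := by rw [Finset.sum_range_succ]; ring

end Probability

/-! ### Smallest eigenvalue of a Gram matrix. -/

section SmallestEigenvalue

open scoped MatrixOrder in
theorem posSemidef_sub_smul_one_iff {q : Type*} [Fintype q] [DecidableEq q] [Nonempty q]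
    {V : Matrix q q ℝ} (hV : V.IsHermitian) (c : ℝ) :
    (V - c • (1 : Matrix q q ℝ)).PosSemidef ↔ c ≤ lambdaMin V := by
  have hsa : IsSelfAdjoint V := hV
  rw [← Matrix.le_iff, ← Algebra.algebraMap_eq_smul_one, algebraMap_le_iff_le_spectrum hsa]
  have h := isLeast_lambdaMin hV
  rw [hV.spectrum_real_eq_range_eigenvalues]
  exact ⟨fun hx => hx _ h.1, fun hc x hx => hc.trans (h.2 hx)⟩

theorem isHermitian_gram {p q : Type*} [Fintype p] (A : Matrix p q ℝ) : (Aᵀ * A).IsHermitian := by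
  rw [Matrix.IsHermitian, conjTranspose_eq_transpose_of_trivial, transpose_mul,
    transpose_transpose]

theorem lambdaMin_mul_frobSq_le {p q s : Type*} [Fintype p] [Fintype q] [DecidableEq q]
    [Nonempty q] [Fintype s] (A : Matrix p q ℝ) (W : Matrix q s ℝ) :
    lambdaMin (Aᵀ * A) * frobSq W ≤ frobSq (A * W) := by
  have h1 := (posSemidef_sub_smul_one_iff (isHermitian_gram A) _).mpr le_rfl
  have h2 := (h1.conjTranspose_mul_mul_same W).trace_nonneg
  rw [conjTranspose_eq_transpose_of_trivial, Matrix.mul_sub, Matrix.sub_mul, trace_sub,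
    Matrix.mul_smul, Matrix.smul_mul, trace_smul, Matrix.mul_one, ← frobSq_eq_trace,
    ← Matrix.mul_assoc, ← transpose_mul, Matrix.mul_assoc, ← frobSq_eq_trace, smul_eq_mul] at h2
  linarith

/-- A new observation adds the positive semidefinite rank-one matrix `a aᵀ` to the Gram matrix. -/
theorem monotone_lambdaMin_trueA {n : ℕ} [NeZero n] (a : ℕ → Fin n → ℝ) :
    Monotone fun m => lambdaMin ((trueA a m)ᵀ * trueA a m) := by
  refine monotone_nat_of_le_succ fun m => ?_
  rw [← posSemidef_sub_smul_one_iff (isHermitian_gram _)]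
  have h1 : (trueA a (m + 1))ᵀ * trueA a (m + 1) =
      (trueA a m)ᵀ * trueA a m + vecMulVec (a m) (star (a m)) := by
    ext i j
    simp [mul_apply, trueA, Fin.sum_univ_castSucc, vecMulVec_apply]
  rw [h1, add_sub_right_comm]
  exact ((posSemidef_sub_smul_one_iff (isHermitian_gram _) _).mpr le_rfl).add
    (posSemidef_vecMulVec_self_star _)

end SmallestEigenvalue

/-! ### From Gram matrix deviations to pathwise consistency. -/

section Sample

variable {n d : ℕ}

theorem obsC_mul (a : ℕ → Fin n → ℝ) (X0 : Matrix (Fin n) (Fin d) ℝ)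
    (e : ℕ → Fin n ⊕ Fin d → ℝ) (m : ℕ) {k : ℕ} (X : Matrix (Fin n ⊕ Fin d) (Fin k) ℝ) :
    obsC a X0 e m * X = trueA a m * residual X0 X + errC e m * X := by
  rw [obsC, Matrix.add_mul]
  congr 1
  nth_rw 1 [← fromRows_toRows X]
  rw [trueC, fromCols_mul_fromRows, residual, Matrix.mul_add, Matrix.mul_assoc]

/-- The relative deviation of the Gram matrix of the observations from its expectation, where `U`
has the same column space as `A` and orthonormal columns. -/
theorem abs_frobSq_sub_le {m : ℕ} {S : Matrix (Fin n ⊕ Fin d) (Fin n ⊕ Fin d) ℝ}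
    (hS : S.PosSemidef) {A U : Matrix (Fin m) (Fin n) ℝ} {T : Matrix (Fin n) (Fin n) ℝ}
    (hU : Uᵀ * U = 1) (hA : U * T = A) (E : Matrix (Fin m) (Fin n ⊕ Fin d) ℝ) {lam : ℝ}
    (hlam : 0 < lam) {k : ℕ} (B : Matrix (Fin n) (Fin k) ℝ)
    (X : Matrix (Fin n ⊕ Fin d) (Fin k) ℝ) :
    |frobSq (A * B + E * X) - frobSq (A * B) - m * frobSq (psdSqrt S * X)| ≤
      (Real.sqrt (frobSq (Uᵀ * E) / lam) + Real.sqrt (frobSq (Eᵀ * E - (m : ℝ) • S)) / lam) *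
        (frobSq (A * B) + lam * frobSq X) := by
  have hAB : A * B = U * (T * B) := by rw [← hA, Matrix.mul_assoc]
  have hfAB : frobSq (T * B) = frobSq (A * B) := by rw [hAB, frobSq_isometry_mul hU]
  have p1 := frobSq_nonneg (A * B)
  have p2 := frobSq_nonneg X
  set Q := Eᵀ * E - (m : ℝ) • S with hQ
  have e1 : frobSq (E * X) - m * frobSq (psdSqrt S * X) = trace (Xᵀ * (Q * X)) := by
    rw [frobSq_eq_trace, frobSq_eq_trace, transpose_mul, transpose_mul, psdSqrt_transpose,
      Matrix.mul_assoc, Matrix.mul_assoc Xᵀ, ← Matrix.mul_assoc (psdSqrt S), psdSqrt_mul_self hS,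
      ← Matrix.mul_assoc Eᵀ, hQ, Matrix.sub_mul, Matrix.mul_sub, trace_sub, Matrix.smul_mul,
      Matrix.mul_smul, trace_smul, smul_eq_mul]
  have b1 : |trace (Xᵀ * (Q * X))| ≤ Real.sqrt (frobSq Q) * frobSq X := by
    refine abs_le_of_sq_le_sq ?_ (by positivity)
    rw [mul_pow, Real.sq_sqrt (frobSq_nonneg Q)]
    calc trace (Xᵀ * (Q * X)) ^ 2 ≤ frobSq X * frobSq (Q * X) := trace_transpose_mul_sq_le _ _
      _ ≤ frobSq X * (frobSq Q * frobSq X) := by gcongr; exact frobSq_mul_le _ _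
      _ = _ := by ring
  -- Since `A * B = U * (T * B)`, only the projection `Uᵀ * E` of the errors enters the cross term;
  -- Cauchy–Schwarz and then `4 x y ≤ (x + y)²` finish.
  have b2 : |2 * trace ((A * B)ᵀ * (E * X))| ≤
      Real.sqrt (frobSq (Uᵀ * E) / lam) * (frobSq (A * B) + lam * frobSq X) := by
    refine abs_le_of_sq_le_sq ?_ (by positivity)
    have h1 : trace ((A * B)ᵀ * (E * X)) = trace ((T * B)ᵀ * (Uᵀ * E * X)) := by
      rw [hAB, transpose_mul U]
      simp only [Matrix.mul_assoc]
    have h2 := trace_transpose_mul_sq_le (T * B) (Uᵀ * E * X)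
    rw [← h1, hfAB] at h2
    have h3 := mul_le_mul_of_nonneg_left (frobSq_mul_le (Uᵀ * E) X) p1
    have p3 := frobSq_nonneg (Uᵀ * E)
    rw [mul_pow, mul_pow, Real.sq_sqrt (by positivity)]
    set φ := frobSq (Uᵀ * E) / lam with hφ
    have hφ' : frobSq (Uᵀ * E) = φ * lam := by rw [hφ]; field_simp
    have hφ0 : 0 ≤ φ := by positivity
    rw [hφ'] at h3
    have h4 : 0 ≤ φ * (frobSq (A * B) - lam * frobSq X) ^ 2 := by positivity
    nlinarith
  have e2 : frobSq (A * B + E * X) - frobSq (A * B) - m * frobSq (psdSqrt S * X) =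
      2 * trace ((A * B)ᵀ * (E * X)) + trace (Xᵀ * (Q * X)) := by
    rw [← e1, frobSq_add]; ring
  rw [e2]
  refine (abs_add_le _ _).trans ?_
  have h5 : Real.sqrt (frobSq Q) * frobSq X ≤
      Real.sqrt (frobSq Q) / lam * (frobSq (A * B) + lam * frobSq X) := by
    have : Real.sqrt (frobSq Q) / lam * (frobSq (A * B) + lam * frobSq X) =
        Real.sqrt (frobSq Q) * frobSq X + Real.sqrt (frobSq Q) / lam * frobSq (A * B) := by
      field_simp
      ring
    rw [this]
    have : 0 ≤ Real.sqrt (frobSq Q) / lam * frobSq (A * B) := by positivity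
    linarith
  rw [add_mul]
  exact add_le_add b2 (b1.trans h5)

/-- Pathwise consistency of the total least squares estimators. -/
theorem tendsto_of_perturbation (hn : 1 ≤ n) {S : Matrix (Fin n ⊕ Fin d) (Fin n ⊕ Fin d) ℝ}
    (hS : S.PosSemidef) {X0 : Matrix (Fin n) (Fin d) ℝ} (hrank : (S * augment X0).rank = d)
    {a : ℕ → Fin n → ℝ} {e : ℕ → Fin n ⊕ Fin d → ℝ} {lam : ℕ → ℝ}
    (hlam : ∀ m, lam m = lambdaMin ((trueA a m)ᵀ * trueA a m)) {m0 : ℕ}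
    (hpos : ∀ m, m0 ≤ m → 0 < lam m)
    {U : ∀ m, Matrix (Fin m) (Fin n) ℝ} {T : ℕ → Matrix (Fin n) (Fin n) ℝ}
    (hU : ∀ m, m0 ≤ m → (U m)ᵀ * U m = 1) (hT : ∀ m, m0 ≤ m → U m * T m = trueA a m)
    (h1 : ∀ k j, Tendsto (fun m => ((U m)ᵀ * errC e m) k j ^ 2 / lam m) atTop (𝓝 0))
    (h2 : ∀ j k, Tendsto (fun m => ((errC e m)ᵀ * errC e m - (m : ℝ) • S) j k / lam m)
      atTop (𝓝 0))
    {Xext : ℕ → Matrix (Fin n ⊕ Fin d) (Fin d) ℝ} {Xhat : ℕ → Matrix (Fin n) (Fin d) ℝ}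
    (hest : ∀ m, IsTLSEstimator S (obsC a X0 e m) (Xext m) (Xhat m)) :
    (∀ᶠ m in atTop, IsUnit (Xext m).toRows₂) ∧ Tendsto Xhat atTop (𝓝 X0) := by
  have : NeZero n := ⟨by omega⟩
  obtain ⟨κ, hκ0, hκ⟩ := IsTLSEstimator.frobSq_sub_le hS hrank
  set ε : ℕ → ℝ := fun m => Real.sqrt (frobSq ((U m)ᵀ * errC e m) / lam m) +
    Real.sqrt (frobSq ((errC e m)ᵀ * errC e m - (m : ℝ) • S)) / lam m with hε
  have hε0 : Tendsto ε atTop (𝓝 0) := by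
    have t1 : Tendsto (fun m => frobSq ((U m)ᵀ * errC e m) / lam m) atTop (𝓝 0) := by
      have := tendsto_finsetSum Finset.univ fun k _ =>
        tendsto_finsetSum Finset.univ fun j _ => h1 k j
      simp only [Finset.sum_const_zero] at this
      refine this.congr fun m => ?_
      simp only [frobSq, Finset.sum_div]
    have t2 : Tendsto (fun m => frobSq ((errC e m)ᵀ * errC e m - (m : ℝ) • S) / lam m ^ 2)
        atTop (𝓝 0) := by
      have := tendsto_finsetSum Finset.univ fun k _ =>
        tendsto_finsetSum Finset.univ fun j _ => (h2 k j).pow 2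
      simp only [Finset.sum_const_zero, zero_pow two_ne_zero] at this
      refine this.congr fun m => ?_
      simp only [frobSq, Finset.sum_div, div_pow]
    have t3 := t1.sqrt.add t2.sqrt
    rw [Real.sqrt_zero, add_zero] at t3
    refine t3.congr' ?_
    filter_upwards [eventually_ge_atTop m0] with m hm
    rw [Real.sqrt_div (frobSq_nonneg _) (lam m ^ 2), Real.sqrt_sq (hpos m hm).le]
  have hεκ : Tendsto (fun m => ε m * κ) atTop (𝓝 0) := by simpa using hε0.mul_const κ
  have hmain : ∀ᶠ m in atTop, IsUnit (Xext m).toRows₂ ∧ frobSq (Xhat m - X0) ≤ ε m * κ := by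
    filter_upwards [eventually_ge_atTop m0, hεκ.eventually_le_const one_pos] with m hm hm1
    have hl := hpos m hm
    refine hκ (obsC a X0 e m) (trueA a m) m (lam m) (ε m) hl ?_ hm1 ?_ ?_ _ _ (hest m)
    · positivity
    · intro W
      rw [hlam]
      exact lambdaMin_mul_frobSq_le _ _
    · intro X
      rw [obsC_mul]
      exact abs_frobSq_sub_le hS (hU m hm) (hT m hm) _ hl _ _
  refine ⟨hmain.mono fun m h => h.1, ?_⟩
  refine tendsto_pi_nhds.mpr fun i => tendsto_pi_nhds.mpr fun j => ?_
  rw [tendsto_iff_norm_sub_tendsto_zero]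
  have t4 : Tendsto (fun m => Real.sqrt (ε m * κ)) atTop (𝓝 0) := by
    simpa using hεκ.sqrt
  refine squeeze_zero' (Eventually.of_forall fun m => norm_nonneg _) ?_ t4
  filter_upwards [hmain] with m hm
  exact Real.abs_le_sqrt ((sq_apply_le_frobSq (Xhat m - X0) i j).trans hm.2)

end Sample

/-! ### Almost sure convergence of the error terms. -/

section Errors

variable {ι Ω : Type*} [MeasurableSpace Ω] {μ : Measure Ω}

theorem abs_rpow_two_mul (x r : ℝ) : |x| ^ (2 * r) = (x ^ 2) ^ r := by
  rw [Real.rpow_mul (abs_nonneg x), Real.rpow_two, sq_abs]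

/-- A finite supremum of lower integrals carries integrability as well as the bound; a Bochner
integral of a non-integrable function would be the default value 0. -/
theorem exists_moment_bound {δ : ℕ → Ω → ι → ℝ} (hmeas : ∀ i j, Measurable fun ω => δ i ω j) {r : ℝ}
    (h : (⨆ i, ⨆ j, ∫⁻ ω, ENNReal.ofReal (|δ i ω j| ^ (2 * r)) ∂μ) < ⊤) :
    ∃ K : ℝ, ∀ i j, Integrable (fun ω => (δ i ω j ^ 2) ^ r) μ ∧
      ∫ ω, (δ i ω j ^ 2) ^ r ∂μ ≤ K := by
  simp only [abs_rpow_two_mul] at h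
  refine ⟨(⨆ i, ⨆ j, ∫⁻ ω, ENNReal.ofReal ((δ i ω j ^ 2) ^ r) ∂μ).toReal, fun i j => ?_⟩
  have hle := le_iSup₂ (f := fun i j => ∫⁻ ω, ENNReal.ofReal ((δ i ω j ^ 2) ^ r) ∂μ) i j
  have hm : AEStronglyMeasurable (fun ω => (δ i ω j ^ 2) ^ r) μ :=
    (((hmeas i j).pow_const 2).pow_const r).aestronglyMeasurable
  have h0 : 0 ≤ᵐ[μ] fun ω => (δ i ω j ^ 2) ^ r := ae_of_all _ fun ω => by positivity
  constructor
  · rw [← lintegral_ofReal_ne_top_iff_integrable hm h0]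
    exact (hle.trans_lt h).ne
  · rw [integral_eq_lintegral_of_nonneg_ae h0 hm]
    exact ENNReal.toReal_mono h.ne hle

/-- The quadratic form of `S` at `x` is the second moment of `∑ j, x j * X j`. -/
theorem posSemidef_of_covariance [Fintype ι] {X : Ω → ι → ℝ} (hX : ∀ j, MemLp (fun ω => X ω j) 2 μ)
    {S : Matrix ι ι ℝ} (hS : ∀ j k, ∫ ω, X ω j * X ω k ∂μ = S j k) : S.PosSemidef := by
  refine PosSemidef.of_dotProduct_mulVec_nonneg ?_ fun x => ?_
  · ext j k
    rw [conjTranspose_eq_transpose_of_trivial, transpose_apply, ← hS, ← hS]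
    simp only [mul_comm]
  · have hint : ∀ j k, Integrable (fun ω => X ω j * X ω k) μ := fun j k =>
      (hX j).integrable_mul (hX k)
    have : star x ⬝ᵥ S *ᵥ x = ∫ ω, (∑ j, x j * X ω j) ^ 2 ∂μ := by
      have e : ∀ ω, (∑ j, x j * X ω j) ^ 2 = ∑ j, ∑ k, x j * x k * (X ω j * X ω k) := by
        intro ω
        rw [sq, Finset.sum_mul_sum]
        exact Finset.sum_congr rfl fun j _ => Finset.sum_congr rfl fun k _ => by ring
      simp only [e]
      rw [integral_finsetSum _ fun j _ => integrable_finsetSum _ fun k _ =>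
        (hint j k).const_mul _]
      simp only [dotProduct, mulVec, star_trivial, Finset.mul_sum]
      refine Finset.sum_congr rfl fun j _ => ?_
      rw [integral_finsetSum _ fun k _ => (hint j k).const_mul _]
      refine Finset.sum_congr rfl fun k _ => ?_
      rw [integral_const_mul, hS]; ring
    rw [this]
    exact integral_nonneg fun ω => sq_nonneg _

theorem add_rpow_le_four_mul {r : ℝ} (hr1 : 1 ≤ r) (hr2 : r ≤ 2) {x y : ℝ} (hx : 0 ≤ x)
    (hy : 0 ≤ y) : (x + y) ^ r ≤ 4 * (x ^ r + y ^ r) := by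
  have h4 : (2 : ℝ) ^ r ≤ 4 := by
    calc (2 : ℝ) ^ r ≤ 2 ^ (2 : ℝ) := Real.rpow_le_rpow_of_exponent_le (by norm_num) hr2
      _ = 4 := by norm_num
  have key : ∀ z : ℝ, 0 ≤ z → (2 * z) ^ r ≤ 4 * z ^ r := fun z hz => by
    rw [Real.mul_rpow (by norm_num) hz]
    gcongr
  have hxr := Real.rpow_nonneg hx r
  have hyr := Real.rpow_nonneg hy r
  rcases le_total x y with h | h
  · have : (x + y) ^ r ≤ (2 * y) ^ r := by gcongr; linarith
    linarith [key y hy]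
  · have : (x + y) ^ r ≤ (2 * x) ^ r := by gcongr; linarith
    linarith [key x hx]

theorem abs_mul_sub_rpow_le {r : ℝ} (hr1 : 1 ≤ r) (hr2 : r ≤ 2) (x y s : ℝ) :
    |x * y - s| ^ r ≤ 4 * ((x ^ 2) ^ r + (y ^ 2) ^ r + |s| ^ r) := by
  have h1 : |x * y - s| ^ r ≤ (|x * y| + |s|) ^ r := by
    gcongr
    exact abs_sub _ _
  have h2 : |x * y| ^ r ≤ (x ^ 2) ^ r + (y ^ 2) ^ r := by
    have hx : 0 ≤ (x ^ 2) ^ r := by positivity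
    have hy : 0 ≤ (y ^ 2) ^ r := by positivity
    rcases le_total |x| |y| with h | h
    · have : |x * y| ^ r ≤ (y ^ 2) ^ r := by
        gcongr
        rw [abs_mul, ← sq_abs y]; nlinarith [abs_nonneg y]
      linarith
    · have : |x * y| ^ r ≤ (x ^ 2) ^ r := by
        gcongr
        rw [abs_mul, ← sq_abs x]; nlinarith [abs_nonneg x]
      linarith
  linarith [add_rpow_le_four_mul hr1 hr2 (abs_nonneg (x * y)) (abs_nonneg s)]

variable [IsProbabilityMeasure μ] {δ : ℕ → Ω → ι → ℝ} {r K : ℝ}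

/-- Products of two errors have bounded moments of order `r`, half the order assumed for the errors,
so the strong law applies to the centred products. -/
theorem ae_tendsto_gram_entry (hmeas : ∀ i, Measurable (δ i)) (hindep : iIndepFun δ μ)
    {S : Matrix ι ι ℝ} (hcov : ∀ i j k, ∫ ω, δ i ω j * δ i ω k ∂μ = S j k)
    (hr1 : 1 ≤ r) (hr2 : r ≤ 2)
    (hK : ∀ i j, Integrable (fun ω => (δ i ω j ^ 2) ^ r) μ ∧ ∫ ω, (δ i ω j ^ 2) ^ r ∂μ ≤ K)
    {b : ℕ → ℝ} (hb : Monotone b) (hpos : ∀ i, 0 < b i) (hlim : Tendsto b atTop atTop)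
    (hs : Summable fun i => 1 / b i ^ r) (j k : ι) :
    ∀ᵐ ω ∂μ, Tendsto (fun m => (∑ i ∈ Finset.range m, (δ i ω j * δ i ω k - S j k)) / b m) atTop
      (𝓝 0) := by
  have hm : ∀ i j, Measurable fun ω => δ i ω j := fun i j => (measurable_pi_apply j).comp (hmeas i)
  have h2 : ∀ i j, MemLp (fun ω => δ i ω j) 2 μ := fun i j =>
    memLp_two_of_integrable_sq_rpow (hm i j) hr1 (hK i j).1
  have hint : ∀ i, Integrable (fun ω => δ i ω j * δ i ω k) μ := fun i =>
    (h2 i j).integrable_mul (h2 i k)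
  have hξm : ∀ i, Measurable fun ω => δ i ω j * δ i ω k - S j k := fun i =>
    ((hm i j).mul (hm i k)).sub_const _
  have hbd : ∀ i, Integrable
      (fun ω => 4 * ((δ i ω j ^ 2) ^ r + (δ i ω k ^ 2) ^ r + |S j k| ^ r)) μ := fun i =>
    (((hK i j).1.add (hK i k).1).add (integrable_const _)).const_mul 4
  have hξr : ∀ i, Integrable (fun ω => |δ i ω j * δ i ω k - S j k| ^ r) μ := fun i =>
    Integrable.mono' (hbd i) ((hξm i).abs.pow_const r).aestronglyMeasurable
      (ae_of_all _ fun ω => by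
        rw [Real.norm_of_nonneg (by positivity)]
        exact abs_mul_sub_rpow_le hr1 hr2 _ _ _)
  refine ae_tendsto_sum_div hξm ?_ hr1 hr2 hξr (K := 4 * (K + K + |S j k| ^ r)) ?_ ?_ hb hpos hlim
    hs
  · exact hindep.comp (fun _ v => v j * v k - S j k) fun _ =>
      ((measurable_pi_apply j).mul (measurable_pi_apply k)).sub_const _
  · intro i
    refine (integral_mono (hξr i) (hbd i) fun ω => abs_mul_sub_rpow_le hr1 hr2 _ _ _).trans ?_
    have hadd : Integrable (fun ω => (δ i ω j ^ 2) ^ r + (δ i ω k ^ 2) ^ r) μ :=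
      (hK i j).1.add (hK i k).1
    generalize |S j k| ^ r = c
    rw [integral_const_mul, integral_add hadd (integrable_const c),
      integral_add (hK i j).1 (hK i k).1]
    have h3 := (hK i j).2
    have h4 := (hK i k).2
    simp only [integral_const, probReal_univ, one_smul]
    linarith
  · intro i
    rw [integral_sub (hint i) (integrable_const _), hcov]
    simp

/-- The coefficients change with `m`, so there are no partial sums of one series. Instead the `r`-th
powers of these variables have summable expectations, hence are summable almost surely; no relation
between different `m` is used. -/
theorem ae_tendsto_projected_entry (hmeas : ∀ i, Measurable (δ i)) (hindep : iIndepFun δ μ)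
    (hmean : ∀ i j, ∫ ω, δ i ω j ∂μ = 0) (hr1 : 1 ≤ r) (hr2 : r ≤ 2)
    (hK : ∀ i j, Integrable (fun ω => (δ i ω j ^ 2) ^ r) μ ∧ ∫ ω, (δ i ω j ^ 2) ^ r ∂μ ≤ K)
    {b : ℕ → ℝ} (hpos : ∀ i, 0 < b i) (hs : Summable fun i => 1 / b i ^ r) (j : ι)
    (u : ℕ → ℕ → ℝ) (N : ℕ → ℕ) (hu : ∀ m, ∑ i ∈ Finset.range (N m), u m i ^ 2 ≤ 1) :
    ∀ᵐ ω ∂μ, Tendsto (fun m => (∑ i ∈ Finset.range (N m), u m i * δ i ω j) ^ 2 / b m) atTop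
      (𝓝 0) := by
  have hm : ∀ i j, Measurable fun ω => δ i ω j := fun i j => (measurable_pi_apply j).comp (hmeas i)
  have hK0 : 0 ≤ K := le_trans (integral_nonneg fun ω => by positivity) (hK 0 j).2
  have hind : iIndepFun (fun i ω => δ i ω j) μ :=
    hindep.comp (fun _ v => v j) fun _ => measurable_pi_apply j
  have hR := fun m => integral_sum_mul_sq_rpow_le (fun i => hm i j) hind hr1 hr2
    (fun i => (hK i j).1) (fun i => (hK i j).2) (fun i => hmean i j) (u m) (N m) (hu m)
  set A : ℝ := 20 * ((2 + K) * (1 + K) + K)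
  have hA : 0 ≤ A := by positivity
  have hsum := ae_summable_of_summable_integral (μ := μ)
    (f := fun m ω => ((∑ i ∈ Finset.range (N m), u m i * δ i ω j) ^ 2) ^ r * (1 / b m ^ r))
    (fun m => (hR m).1.mul_const _) (fun m ω => by have := hpos m; positivity) (by
      refine Summable.of_nonneg_of_le (fun m => integral_nonneg fun ω => ?_) (fun m => ?_)
        (hs.mul_left A)
      · have := hpos m; positivity
      · have := hpos m
        rw [integral_mul_const]
        refine mul_le_mul_of_nonneg_right ((hR m).2.trans ?_) (by positivity)
        exact mul_le_of_le_one_right hA (hu m))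
  filter_upwards [hsum] with ω hω
  have h1 := hω.tendsto_atTop_zero
  have h2 := h1.rpow_const (p := r⁻¹) (Or.inr (by positivity))
  rw [Real.zero_rpow (by positivity)] at h2
  refine h2.congr fun m => ?_
  rw [← div_eq_mul_one_div, ← Real.div_rpow (sq_nonneg _) (hpos m).le,
    Real.rpow_rpow_inv (by have := hpos m; positivity) (by positivity)]

end Errors

end TLS

/-! ### Strong consistency. -/

theorem mainTheorem3 {n d : ℕ} (hn : 1 ≤ n) (hd : 1 ≤ d)
    -- true regressors, true parameter, error covariance matrix
    (a : ℕ → Fin n → ℝ) (X0 : Matrix (Fin n) (Fin d) ℝ)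
    (S : Matrix (Fin n ⊕ Fin d) (Fin n ⊕ Fin d) ℝ)
    -- the error vectors: independent, centred, with common covariance matrix `S`
    {Ω : Type*} [MeasurableSpace Ω] (μ : Measure Ω) [IsProbabilityMeasure μ]
    (δ : ℕ → Ω → Fin n ⊕ Fin d → ℝ) (hmeas : ∀ i, Measurable (δ i))
    (hindep : iIndepFun δ μ)
    (hmean : ∀ i j, ∫ ω, δ i ω j ∂μ = 0)
    (hcov : ∀ i j k, ∫ ω, δ i ω j * δ i ω k ∂μ = S j k)
    (hrank : (S * TLS.augment X0).rank = d)
    -- the moment condition and the summability condition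
    (r : ℝ) (hr1 : 1 ≤ r) (hr2 : r ≤ 2)
    (hmoment : (⨆ i, ⨆ j, ∫⁻ ω, ENNReal.ofReal (|δ i ω j| ^ (2 * r)) ∂μ) < ⊤)
    (m0 : ℕ) (hm0 : 1 ≤ m0)
    (hpos : ∀ m, m0 ≤ m → 0 < TLS.lambdaMin ((TLS.trueA a m)ᵀ * TLS.trueA a m))
    (hsum : Summable fun k : ℕ =>
      1 / TLS.lambdaMin ((TLS.trueA a (m0 + k))ᵀ * TLS.trueA a (m0 + k)) ^ r) :
    -- estimation can always be carried out ...
    (∀ (m : ℕ) (ω : Ω), ∃ Xext Xhat,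
      TLS.IsTLSEstimator S (TLS.obsC a X0 (fun i => δ i ω) m) Xext Xhat) ∧
    -- ... and, whatever choices are made, it eventually succeeds and is strongly consistent
    ∀ (Xext : ℕ → Ω → Matrix (Fin n ⊕ Fin d) (Fin d) ℝ)
      (Xhat : ℕ → Ω → Matrix (Fin n) (Fin d) ℝ),
      (∀ m ω, TLS.IsTLSEstimator S (TLS.obsC a X0 (fun i => δ i ω) m) (Xext m ω) (Xhat m ω)) →
      ∀ᵐ ω ∂μ, (∀ᶠ m in atTop, IsUnit (Xext m ω).toRows₂) ∧
        Tendsto (fun m => Xhat m ω) atTop (𝓝 X0) := by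
  have hm : ∀ i j, Measurable fun ω => δ i ω j := fun i j => (measurable_pi_apply j).comp (hmeas i)
  obtain ⟨K, hK⟩ := TLS.exists_moment_bound hm hmoment
  have hS : S.PosSemidef := TLS.posSemidef_of_covariance
    (fun j => TLS.memLp_two_of_integrable_sq_rpow (hm 0 j) hr1 (hK 0 j).1) (hcov 0)
  refine ⟨fun m ω => TLS.exists_isTLSEstimator hS X0 hrank _, fun Xext Xhat hest => ?_⟩
  have : NeZero n := ⟨by omega⟩
  set lam : ℕ → ℝ := fun m => TLS.lambdaMin ((TLS.trueA a m)ᵀ * TLS.trueA a m) with hlam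
  have hmono : Monotone lam := TLS.monotone_lambdaMin_trueA a
  -- Freezing `lam` below `m0` gives a norming sequence that is positive and monotone from index 0
  -- on, and changes nothing in the limit.
  set b : ℕ → ℝ := fun m => lam (max m0 m) with hb
  have hbmono : Monotone b := fun i j hij => hmono (max_le_max le_rfl hij)
  have hbpos : ∀ m, 0 < b m := fun m => hpos _ (le_max_left _ _)
  have hbsum : Summable fun m => 1 / b m ^ r := by
    rw [← summable_nat_add_iff m0]
    refine hsum.congr fun k => ?_
    have hmax : max m0 (k + m0) = m0 + k := by omega
    change _ = 1 / lam (max m0 (k + m0)) ^ r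
    rw [hmax]
  -- The terms `1 / b m ^ r` of a convergent series tend to zero.
  have hblim : Tendsto b atTop atTop := by
    have h1 : Tendsto (fun m => b m ^ r) atTop atTop := by
      have h2 := hbsum.tendsto_atTop_zero
      have h3 : Tendsto (fun m => 1 / b m ^ r) atTop (𝓝[>] 0) :=
        tendsto_nhdsWithin_iff.mpr ⟨h2, Eventually.of_forall fun m => by
          have := hbpos m
          change 0 < 1 / b m ^ r
          positivity⟩
      exact h3.inv_tendsto_nhdsGT_zero.congr fun m => by simp
    have h4 := (tendsto_rpow_atTop (y := r⁻¹) (by positivity)).comp h1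
    refine h4.congr fun m => ?_
    exact Real.rpow_rpow_inv (hbpos m).le (by positivity)
  have hbeq : ∀ᶠ m in atTop, b m = lam m := by
    filter_upwards [eventually_ge_atTop m0] with m hm
    simp only [hb, max_eq_right hm]
  -- The implication sits under the existential so that `U` and `T` can be chosen for all `m`; below
  -- `m0` they are the dummy zero matrices.
  have hex : ∀ m, ∃ (U : Matrix (Fin m) (Fin n) ℝ) (T : Matrix (Fin n) (Fin n) ℝ), m0 ≤ m →
      Uᵀ * U = 1 ∧ U * T = TLS.trueA a m := by
    intro m
    by_cases hm : m0 ≤ m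
    · have hr : (TLS.trueA a m).rank = Fintype.card (Fin n) := by
        by_contra hne
        obtain ⟨V, hV0, hV⟩ := TLS.exists_ne_zero_of_rank_ne_card hne
        have h1 := TLS.lambdaMin_mul_frobSq_le (TLS.trueA a m) V
        rw [hV, TLS.frobSq_zero] at h1
        exact hV0 (TLS.eq_zero_of_frobSq_le_zero (nonpos_of_mul_nonpos_right h1 (hpos m hm)))
      obtain ⟨T, hT, T', hTT', -⟩ := TLS.exists_mul_isometry hr
      refine ⟨TLS.trueA a m * T, T', fun _ => ⟨hT, ?_⟩⟩
      rw [Matrix.mul_assoc, hTT', Matrix.mul_one]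
    · exact ⟨0, 0, fun h => absurd h hm⟩
  choose U T hUT using hex
  -- Column `k` of `U`, extended by zero to all of `ℕ`; the sample size `max m0 m` keeps it a unit
  -- vector even for `m < m0`.
  set u : Fin n → ℕ → ℕ → ℝ := fun k m i =>
    if h : i < max m0 m then U (max m0 m) ⟨i, h⟩ k else 0 with hu
  have hu1 : ∀ k m, ∑ i ∈ Finset.range (max m0 m), u k m i ^ 2 ≤ 1 := by
    intro k m
    have h1 := congrFun (congrFun (hUT (max m0 m) (le_max_left _ _)).1 k) k
    rw [mul_apply, one_apply_eq] at h1
    rw [← h1, Finset.sum_range]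
    refine le_of_eq (Finset.sum_congr rfl fun i _ => ?_)
    simp only [hu, Fin.is_lt, dite_true, transpose_apply, sq]
  have hA1 : ∀ᵐ ω ∂μ, ∀ (k : Fin n) (j : Fin n ⊕ Fin d), Tendsto
      (fun m => (∑ i ∈ Finset.range (max m0 m), u k m i * δ i ω j) ^ 2 / b m) atTop (𝓝 0) := by
    rw [ae_all_iff]; intro k
    rw [ae_all_iff]; intro j
    exact TLS.ae_tendsto_projected_entry hmeas hindep hmean hr1 hr2 hK hbpos hbsum j (u k)
      (fun m => max m0 m) (hu1 k)
  have hA2 : ∀ᵐ ω ∂μ, ∀ j k : Fin n ⊕ Fin d, Tendsto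
      (fun m => (∑ i ∈ Finset.range m, (δ i ω j * δ i ω k - S j k)) / b m) atTop (𝓝 0) := by
    rw [ae_all_iff]; intro j
    rw [ae_all_iff]; intro k
    exact TLS.ae_tendsto_gram_entry hmeas hindep hcov hr1 hr2 hK hbmono hbpos hblim hbsum j k
  filter_upwards [hA1, hA2] with ω h1 h2
  refine TLS.tendsto_of_perturbation hn hS hrank (lam := lam) (fun m => rfl) hpos
    (fun m hm => (hUT m hm).1) (fun m hm => (hUT m hm).2) (fun k j => ?_) (fun j k => ?_)
    (e := fun i => δ i ω) (fun m => hest m ω)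
  · refine (h1 k j).congr' ?_
    filter_upwards [hbeq, eventually_ge_atTop m0] with m hbm hm
    have hmax : max m0 m = m := max_eq_right hm
    rw [hbm, mul_apply, Finset.sum_range]
    congr 2
    -- `U (max m0 m)` has a type depending on the sample size, so the size is generalized to `N`
    -- before substituting.
    have : ∀ N, N = m → ∑ i : Fin N, (if h : (i : ℕ) < N then U N ⟨i, h⟩ k else 0) * δ i ω j =
        ∑ i : Fin m, (U m)ᵀ k i * TLS.errC (fun i => δ i ω) m i j := by
      rintro N rfl
      exact Finset.sum_congr rfl fun i _ => by
        simp only [Fin.is_lt, dite_true, transpose_apply]; rfl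
    exact this _ hmax
  · refine (h2 j k).congr' ?_
    filter_upwards [hbeq] with m hbm
    rw [hbm, Finset.sum_sub_distrib, Finset.sum_range]
    congr 1
    simp [TLS.errC, mul_apply]
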